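/- **Conventions.** The model is the word RAM with words of $w$ bits, memory initially zero; a program is fixed independently of the input and of $w$. For a string $S$, $\overleftarrow{S}$ denotes the inverted (reversed) string. The suffix tree of $S$ is the compacted trie of all suffixes of $S$: its nodes are the suffixes of $S$ (the empty one being the root) and the right-branching substrings of $S$. An *online suffix tree algorithm* with time bound $t_{\mathrm{SU}}(n,\sigma)$, for a class $\mathcal A$ of pairs $(n,\sigma)$, is a data structure that reads any text $T[1..n]$ over $\{0,\dots,\sigma-1\}$, $(n,\sigma)\in\mathcal A$, letter by letter from left to right and, after each letter $T[i]$, represents the suffix tree of $\overleftarrow{T[1..i]}$ within the first $O(i)$ words of memory. Every node is represented by a pointer into the used memory that does not change over time, and distinct nodes have distinct pointers. The data structure supports: the update by the next letter (returning the new leaf and the root); for a node, reporting its parent, the length of its label and a position of the text from which its label is read leftwards; and, for a node and a letter, finding the child whose edge label begins with this letter or reporting that there is none. The latter two queries leave the memory unchanged, and each operation takes $O(t_{\mathrm{SU}}(n,\sigma))$ worst-case time. Algorithms are required to work whenever a letter fits into a word ($\sigma\le 2^w$) and $2^w\ge C(n+1)$ for some constant $C$ of the algorithm, i.e. $w\ge\log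 n+O(1)$. The *reversed LZ factorization* (without self-references) of $T$ is the factorization $T=F_1\cdots F_z$ in which each $F_x$ is either the first occurrence of a letter, or the longest (nonempty) prefix of $F_x\cdots F_z$ such that $\overleftarrow{F_x}$ is a substring of $F_1\cdots F_{x-1}$. **Theorem.** Let $\mathcal A$ be any class of pairs $(n,\sigma)$ and let an online suffix tree algorithm with time bound $t_{\mathrm{SU}}(n,\sigma)$ for $\mathcal A$ be given. Then there is a word RAM program that computes the reversed LZ factorization of every string $T[1..n]$ over $\{0,\dots,\sigma-1\}$ with $(n,\sigma)\in\mathcal A$ online, in $O(n)$ space and $O(t_{\mathrm{SU}}(n,\sigma))$ worst-case time per letter. That is: it reads $T$ letter by letter; after each letter $T[i]$ it reports, for the reversed LZ factorization of $T[1..i]$, the number of factors, the starting position of the last factor, and the starting position of an inverted copy of the last factor inside the concatenation of the previous factors (or $0$ if there is none); it spends $O(t_{\mathrm{SU}}(n,\sigma))$ time on each letter, and it uses only the first $O(i)$ words of memory for the first $i$ letters. -/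

import Mathlib

namespace RevLZ

/-! ### The word RAM -/

/-- Arithmetic, bitwise and comparison instructions of the word RAM. -/
inductive BinOp where
  | add | sub | mul | div | mod | and | or | xor | shl | shr | lt | eq

/-- The effect of an instruction on two words of `w` bits; arithmetic is modulo `2 ^ w`. -/
def BinOp.eval (w : ℕ) : BinOp → ℕ → ℕ → ℕ
  | .add, a, b => (a + b) % 2 ^ w
  | .sub, a, b => (a + (2 ^ w - b)) % 2 ^ w
  | .mul, a, b => (a * b) % 2 ^ w
  | .div, a, b => a / b
  | .mod, a, b => a % b
  | .and, a, b => a &&& b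
  | .or, a, b => a ||| b
  | .xor, a, b => a ^^^ b
  | .shl, a, b => (a <<< b) % 2 ^ w
  | .shr, a, b => a >>> b
  | .lt, a, b => if a < b then 1 else 0
  | .eq, a, b => if a = b then 1 else 0

/-- Programs of the word RAM. Registers are named by natural numbers (a program mentions only
finitely many of them); memory cells are addressed by the content of a register. -/
inductive Prog where
  | skip : Prog
  | const (r k : ℕ) : Prog
  | op (o : BinOp) (r a b : ℕ) : Prog
  | load (r a : ℕ) : Prog
  | store (a b : ℕ) : Prog
  | seq (p q : Prog) : Prog
  | ifNonzero (r : ℕ) (p q : Prog) : Prog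
  | whileNonzero (r : ℕ) (p : Prog) : Prog

/-- Contents of the registers and of the memory. -/
structure Config where
  reg : ℕ → ℕ
  mem : ℕ → ℕ

/-- `Exec w p s s' τ m`: with word size `w`, the program `p` started in `s` halts in `s'` after `τ`
steps, and every memory address that it reads or writes is smaller than `m`
(`m` is the largest such address plus one, or `0`). -/
inductive Exec (w : ℕ) : Prog → Config → Config → ℕ → ℕ → Prop
  | skip (s : Config) : Exec w .skip s s 1 0
  | const (s : Config) (r k : ℕ) :
      Exec w (.const r k) s ⟨Function.update s.reg r (k % 2 ^ w), s.mem⟩ 1 0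
  | op (s : Config) (o : BinOp) (r a b : ℕ) :
      Exec w (.op o r a b) s
        ⟨Function.update s.reg r (o.eval w (s.reg a) (s.reg b)), s.mem⟩ 1 0
  | load (s : Config) (r a : ℕ) :
      Exec w (.load r a) s
        ⟨Function.update s.reg r (s.mem (s.reg a)), s.mem⟩ 1 (s.reg a + 1)
  | store (s : Config) (a b : ℕ) :
      Exec w (.store a b) s
        ⟨s.reg, Function.update s.mem (s.reg a) (s.reg b)⟩ 1 (s.reg a + 1)
  | seq {p q : Prog} {s s' s'' : Config} {τ τ' m m' : ℕ} :
      Exec w p s s' τ m → Exec w q s' s'' τ' m' →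
      Exec w (.seq p q) s s'' (τ + τ') (max m m')
  | ifTrue {r : ℕ} {p q : Prog} {s s' : Config} {τ m : ℕ} :
      s.reg r ≠ 0 → Exec w p s s' τ m → Exec w (.ifNonzero r p q) s s' (τ + 1) m
  | ifFalse {r : ℕ} {p q : Prog} {s s' : Config} {τ m : ℕ} :
      s.reg r = 0 → Exec w q s s' τ m → Exec w (.ifNonzero r p q) s s' (τ + 1) m
  | whileDone {r : ℕ} {p : Prog} {s : Config} :
      s.reg r = 0 → Exec w (.whileNonzero r p) s s 1 0
  | whileStep {r : ℕ} {p : Prog} {s s' s'' : Config} {τ τ' m m' : ℕ} :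
      s.reg r ≠ 0 → Exec w p s s' τ m → Exec w (.whileNonzero r p) s' s'' τ' m' →
      Exec w (.whileNonzero r p) s s'' (τ + τ' + 1) (max m m')

/-- `Call w p args M M' out B m`: the program `p`, started on memory `M` with the words `args` in
registers `0, 1, …` (and `0` in all other registers), halts with memory `M'` and register contents
`out`, takes at most `B` steps and only accesses memory cells with address smaller than `m`.
Only the memory is kept from one call to the next. -/
def Call (w : ℕ) (p : Prog) (args : List ℕ) (M M' : ℕ → ℕ) (out : ℕ → ℕ) (B : ℝ) (m : ℕ) : Prop :=
  ∃ τ m₀ : ℕ, Exec w p ⟨fun i => args.getD i 0, M⟩ ⟨out, M'⟩ τ m₀ ∧ (τ : ℝ) ≤ B ∧ m₀ ≤ m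

/-! ### Suffix trees -/

/-- The labels of the nodes of the suffix tree of `S`, the compacted trie of all suffixes of `S`:
the suffixes of `S` (the empty one is the label of the root) and the right-branching substrings. -/
def IsNode (S u : List ℕ) : Prop :=
  u <:+ S ∨ ∃ a b : ℕ, a ≠ b ∧ u ++ [a] <:+: S ∧ u ++ [b] <:+: S

/-- In the suffix tree of `S`, the node (with label) `v` is the child of the node `u` along the edge
whose label starts with the letter `c`. -/
def IsChild (S u : List ℕ) (c : ℕ) (v : List ℕ) : Prop :=
  IsNode S u ∧ IsNode S v ∧ u ++ [c] <+: v ∧ ∀ v', IsNode S v' → u ++ [c] <+: v' → v <+: v'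

/-- The three word RAM programs of an online suffix tree data structure: processing a letter,
reading the data of a node, and moving from a node to a child. -/
structure SuffixTreeProgram where
  update : Prog
  node : Prog
  child : Prog

/-- On the text `T` (letters smaller than `σ`), with word size `w`, the data structure `D`, starting
from an all-zero memory, maintains the suffix tree of the inverted text under the arrival of the
letters of `T` from left to right, where each operation takes at most `B` steps and only the first
`C * i` memory cells are in use while the processed portion of `T` has length `i`.
`M i` is the memory after `i` letters, and `h u` is the word (pointer) that represents the node with
label `u`. -/
def SuffixTreeProgram.Maintains (D : SuffixTreeProgram) (C w σ : ℕ) (B : ℝ) (T : List ℕ) : Prop :=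
  ∃ (M : ℕ → ℕ → ℕ) (h : List ℕ → ℕ), (∀ a, M 0 a = 0) ∧
    ∀ (i : ℕ) (hi : i < T.length),
      let S := (T.take (i + 1)).reverse
      -- nodes have distinct pointers into the used memory
      Set.InjOn h {u | IsNode S u} ∧
      (∀ u, IsNode S u → h u < C * (i + 1)) ∧
      -- update with the next letter; returns the leaf of the new suffix and the root
      (∃ out, Call w D.update [T[i]] (M i) (M (i + 1)) out B (C * (i + 1)) ∧
        out 0 = h S ∧ out 1 = h []) ∧
      -- the node `v`: its parent, the length of its label, and a position `j` of the text
      -- from which its label can be read leftwards, `v = T[j] T[j-1] ⋯`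
      (∀ v, IsNode S v →
        ∃ out, Call w D.node [h v] (M (i + 1)) (M (i + 1)) out B (C * (i + 1)) ∧
          (∀ u c, IsChild S u c v → out 0 = h u) ∧
          out 1 = v.length ∧
          out 2 ≤ i + 1 ∧ v <+: (T.take (out 2)).reverse) ∧
      -- the child of the node `u` by the letter `c`, if there is one
      (∀ u, IsNode S u → ∀ c < σ,
        ∃ out, Call w D.child [h u, c] (M (i + 1)) (M (i + 1)) out B (C * (i + 1)) ∧
          (∀ v, IsChild S u c v → out 0 = 1 ∧ out 1 = h v) ∧
          ((¬ ∃ v, IsChild S u c v) → out 0 = 0))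

/-- `D` solves the suffix tree update problem online in linear space and `O(t n σ)` worst-case time
per letter (and per navigation step), for texts of length `n` over the alphabet `{0, …, σ - 1}`,
for all pairs `(n, σ)` in the class `adm`. The word size is at least `log n + O(1)`, and letters fit
into a word. -/
def SuffixTreeProgram.Solves (D : SuffixTreeProgram) (adm : ℕ → ℕ → Prop) (t : ℕ → ℕ → ℝ) : Prop :=
  ∃ C : ℕ, ∀ (n σ w : ℕ) (T : List ℕ), adm n σ → T.length = n → (∀ a ∈ T, a < σ) →
    C * (n + 1) ≤ 2 ^ w → σ ≤ 2 ^ w → D.Maintains C w σ (C * t n σ) T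

/-! ### The reversed Lempel-Ziv factorization -/

/-- `fs` is the reversed LZ factorization (without self-references) of `T`: each factor is the first
occurrence of a letter, or the longest (nonempty) prefix of the remaining text whose inverted copy
is a substring of the concatenation of the previous factors. -/
def IsRevLZ (T : List ℕ) (fs : List (List ℕ)) : Prop :=
  fs.flatten = T ∧
  ∀ (x : ℕ) (hx : x < fs.length),
    (∃ a, fs[x] = [a] ∧ a ∉ (fs.take x).flatten) ∨
    (fs[x] ≠ [] ∧ fs[x].reverse <:+: (fs.take x).flatten ∧
      ∀ G, G <+: (fs.drop x).flatten → G.reverse <:+: (fs.take x).flatten →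
        G.length ≤ fs[x].length)

/-- The words `z, s, r` describe the last factor in the reversed LZ factorization of the nonempty
string `T`: the factorization has `z` factors, the last factor starts at the (1-based) position `s`,
and `r` is the (1-based) starting position of an inverted copy of the last factor inside the
concatenation of the previous factors, or `0` if there is no inverted copy. -/
def Reports (T : List ℕ) (z s r : ℕ) : Prop :=
  ∃ (gs : List (List ℕ)) (F : List ℕ), IsRevLZ T (gs ++ [F]) ∧
    z = gs.length + 1 ∧ s = gs.flatten.length + 1 ∧
    ((r = 0 ∧ ¬ F.reverse <:+: gs.flatten) ∨
      ∃ A B : List ℕ, gs.flatten = A ++ F.reverse ++ B ∧ r = A.length + 1)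

/-- On the text `T`, with word size `w`, the program `p`, starting from an all-zero memory and run
once for each letter of `T` from left to right, reports after each letter the reversed LZ
factorization of the processed portion, takes at most `B` steps per letter, and only uses the first
`C * i` memory cells while the processed portion of `T` has length `i`. -/
def RevLZOnline (p : Prog) (C w : ℕ) (B : ℝ) (T : List ℕ) : Prop :=
  ∃ M : ℕ → ℕ → ℕ, (∀ a, M 0 a = 0) ∧
    ∀ (i : ℕ) (hi : i < T.length),
      ∃ out, Call w p [T[i]] (M i) (M (i + 1)) out B (C * (i + 1)) ∧
        Reports (T.take (i + 1)) (out 0) (out 1) (out 2)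

/-- `p` computes the reversed LZ factorization online in linear space and `O(t n σ)` worst-case time
per letter, for texts of length `n` over `{0, …, σ - 1}`, for all pairs `(n, σ)` in `adm`. -/
def ComputesRevLZ (p : Prog) (adm : ℕ → ℕ → Prop) (t : ℕ → ℕ → ℝ) : Prop :=
  ∃ C : ℕ, ∀ (n σ w : ℕ) (T : List ℕ), adm n σ → T.length = n → (∀ a ∈ T, a < σ) →
    C * (n + 1) ≤ 2 ^ w → σ ≤ 2 ^ w → RevLZOnline p C w (C * t n σ) T

end RevLZ

/-! A string occurs inverted in `T[1..k]` exactly if it occurs in the inversion of `T[1..k]`. So the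
current factor `F`, read forwards, is spelled downwards from the root of the suffix tree of the
inverted text, and the next letter extends it by one step down. Prefixes of admissible factors are
admissible, so each letter either lengthens the last factor (`IsRevLZ.extend`) or opens a factor of
length one (`IsRevLZ.next`). A bounded number of tree operations per letter suffices, which gives a
worst-case bound without amortization.

The tree contains the whole processed text, whereas the inverted copy must end before the start `s`
of `F`. Hence a table stores at each node `v` the least `j ≥ 1` such that `v` is a prefix of the
inversion of `T[1..j]`. Inverted prefixes of the text are nodes, so a string has the same first
occurrence as its locus, the highest node at or below it (`Locus.firstOcc`). It is admissible iff `j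
< s` (`FirstOcc.infix_iff`).

Prepending a letter creates, besides the leaf, at most one node, the parent of the leaf
(`new_node_unique`, `parent_leaf`). It subdivides an old edge and inherits the entry of the lower
end of that edge (`old_child`, `TableInv.succ_of_zero`). This lower end is found in a second copy of
the data structure that lags one letter behind; pointers never change, so those of the two copies
agree. A table entry `0` reveals that the parent is new. Since only one internal node can appear,
the locus of `F` either stays or moves up to its parent (`Locus.cons`).

On the machine, addresses are split by their residue modulo `8`, so that both copies and the tables
have memories of their own, initially zero. `Exec.inLane` simulates a program inside one such lane,
and `Cmd.wp_sound` reduces the correctness of the algorithm to weakest preconditions. -/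

namespace RevLZ

/-! ### Running a program on one lane of an interleaved memory -/

/-- All registers mentioned by the program are smaller than `R`. -/
def Prog.RegBelow (R : ℕ) : Prog → Prop
  | .skip => True
  | .const r _ => r < R
  | .op _ r a b => r < R ∧ a < R ∧ b < R
  | .load r a => r < R ∧ a < R
  | .store a b => a < R ∧ b < R
  | .seq p q => p.RegBelow R ∧ q.RegBelow R
  | .ifNonzero r p q => r < R ∧ p.RegBelow R ∧ q.RegBelow R
  | .whileNonzero r p => r < R ∧ p.RegBelow R

theorem Prog.RegBelow.mono {R R' : ℕ} (h : R ≤ R') {p : Prog} (hp : p.RegBelow R) :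
    p.RegBelow R' := by
  induction p with
  | skip => trivial
  | const r k => exact lt_of_lt_of_le hp h
  | op o r a b => exact ⟨hp.1.trans_le h, hp.2.1.trans_le h, hp.2.2.trans_le h⟩
  | load r a => exact ⟨hp.1.trans_le h, hp.2.trans_le h⟩
  | store a b => exact ⟨hp.1.trans_le h, hp.2.trans_le h⟩
  | seq p q ihp ihq => exact ⟨ihp hp.1, ihq hp.2⟩
  | ifNonzero r p q ihp ihq => exact ⟨hp.1.trans_le h, ihp hp.2.1, ihq hp.2.2⟩
  | whileNonzero r p ih => exact ⟨hp.1.trans_le h, ih hp.2⟩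

/-- Registers from such an `R` on are free for address computations and for variables that must
survive the calls. -/
theorem Prog.exists_regBelow (p : Prog) : ∃ R, p.RegBelow R := by
  induction p with
  | skip => exact ⟨0, trivial⟩
  | const r k => exact ⟨r + 1, Nat.lt_succ_self r⟩
  | op o r a b => exact ⟨r + a + b + 1, by simp only [Prog.RegBelow]; omega⟩
  | load r a => exact ⟨r + a + 1, by simp only [Prog.RegBelow]; omega⟩
  | store a b => exact ⟨a + b + 1, by simp only [Prog.RegBelow]; omega⟩
  | seq p q ihp ihq =>
    obtain ⟨R, hR⟩ := ihp
    obtain ⟨R', hR'⟩ := ihq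
    exact ⟨R + R', hR.mono (by omega), hR'.mono (by omega)⟩
  | ifNonzero r p q ihp ihq =>
    obtain ⟨R, hR⟩ := ihp
    obtain ⟨R', hR'⟩ := ihq
    exact ⟨R + R' + r + 1, by omega, hR.mono (by omega), hR'.mono (by omega)⟩
  | whileNonzero r p ih =>
    obtain ⟨R, hR⟩ := ih
    exact ⟨R + r + 1, by omega, hR.mono (by omega)⟩

/-- The program halts from `t` within `B` steps, using addresses below `m`, in a configuration
that satisfies `Q`. -/
def Runs (w : ℕ) (p : Prog) (t : Config) (B m : ℕ) (Q : Config → Prop) : Prop :=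
  ∃ t' τ m', Exec w p t t' τ m' ∧ τ ≤ B ∧ m' ≤ m ∧ Q t'

theorem Runs.mono {w : ℕ} {p : Prog} {t : Config} {B B' m m' : ℕ} {Q Q' : Config → Prop}
    (h : Runs w p t B m Q) (hB : B ≤ B') (hm : m ≤ m') (hQ : ∀ t', Q t' → Q' t') :
    Runs w p t B' m' Q' := by
  obtain ⟨t', τ, m₀, he, h1, h2, h3⟩ := h
  exact ⟨t', τ, m₀, he, h1.trans hB, h2.trans hm, hQ _ h3⟩

/-- The postcondition of the first program is itself a `Runs` statement, so a long program is
verified by nesting, and unification computes the intermediate configurations. -/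
theorem Runs.seq {w : ℕ} {p q : Prog} {t : Config} {B B' m : ℕ} {Q : Config → Prop}
    (h : Runs w p t B m fun t' => Runs w q t' B' m Q) : Runs w (.seq p q) t (B + B') m Q := by
  obtain ⟨t₁, τ₁, m₁, he₁, hB₁, hm₁, t₂, τ₂, m₂, he₂, hB₂, hm₂, hQ⟩ := h
  exact ⟨t₂, _, _, .seq he₁ he₂, add_le_add hB₁ hB₂, max_le hm₁ hm₂, hQ⟩

theorem Runs.skip {w : ℕ} {t : Config} {m : ℕ} {Q : Config → Prop} (h : Q t) :
    Runs w .skip t 1 m Q :=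
  ⟨_, _, _, .skip t, le_rfl, Nat.zero_le _, h⟩

theorem Runs.const {w r k : ℕ} {t : Config} {m : ℕ} {Q : Config → Prop} (hk : k < 2 ^ w)
    (h : Q ⟨Function.update t.reg r k, t.mem⟩) : Runs w (.const r k) t 1 m Q := by
  refine ⟨_, _, _, .const t r k, le_rfl, Nat.zero_le _, ?_⟩
  rwa [Nat.mod_eq_of_lt hk]

theorem Runs.op {w : ℕ} {o : BinOp} {r a b : ℕ} {t : Config} {m : ℕ} {Q : Config → Prop}
    (h : Q ⟨Function.update t.reg r (o.eval w (t.reg a) (t.reg b)), t.mem⟩) :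
    Runs w (.op o r a b) t 1 m Q :=
  ⟨_, _, _, .op t o r a b, le_rfl, Nat.zero_le _, h⟩

theorem Runs.move {w : ℕ} {r a : ℕ} {t : Config} {m : ℕ} {Q : Config → Prop}
    (h : Q ⟨Function.update t.reg r (t.reg a), t.mem⟩) :
    Runs w (.op .or r a a) t 1 m Q :=
  Runs.op (by simpa [BinOp.eval] using h)

theorem Runs.load {w r a : ℕ} {t : Config} {m : ℕ} {Q : Config → Prop} (hm : t.reg a + 1 ≤ m)
    (h : Q ⟨Function.update t.reg r (t.mem (t.reg a)), t.mem⟩) : Runs w (.load r a) t 1 m Q :=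
  ⟨_, _, _, .load t r a, le_rfl, hm, h⟩

theorem Runs.store {w a b : ℕ} {t : Config} {m : ℕ} {Q : Config → Prop} (hm : t.reg a + 1 ≤ m)
    (h : Q ⟨t.reg, Function.update t.mem (t.reg a) (t.reg b)⟩) : Runs w (.store a b) t 1 m Q :=
  ⟨_, _, _, .store t a b, le_rfl, hm, h⟩

theorem Runs.ifNonzero {w r : ℕ} {p q : Prog} {t : Config} {B m : ℕ} {Q : Config → Prop}
    (hp : t.reg r ≠ 0 → Runs w p t B m Q) (hq : t.reg r = 0 → Runs w q t B m Q) :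
    Runs w (.ifNonzero r p q) t (B + 1) m Q := by
  by_cases h : t.reg r = 0
  · obtain ⟨t', τ, m₀, he, h1, h2, h3⟩ := hq h
    exact ⟨t', _, m₀, .ifFalse h he, by omega, h2, h3⟩
  · obtain ⟨t', τ, m₀, he, h1, h2, h3⟩ := hp h
    exact ⟨t', _, m₀, .ifTrue h he, by omega, h2, h3⟩

/-- Register `R` receives the address of cell `a` (content of a register) of lane `o`. -/
def laneAddr (R o a : ℕ) : Prog :=
  .seq (.const R 8) (.seq (.op .mul R a R) (.seq (.const (R + 1) o) (.op .add R R (R + 1))))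

/-- The program that runs on lane `o` of the memory, the cells with addresses `8 * a + o`. -/
def Prog.inLane (R o : ℕ) : Prog → Prog
  | .skip => .skip
  | .const r k => .const r k
  | .op f r a b => .op f r a b
  | .load r a => .seq (laneAddr R o a) (.load r R)
  | .store a b => .seq (laneAddr R o a) (.store R b)
  | .seq p q => .seq (p.inLane R o) (q.inLane R o)
  | .ifNonzero r p q => .ifNonzero r (p.inLane R o) (q.inLane R o)
  | .whileNonzero r p => .whileNonzero r (p.inLane R o)

/-- Register `R` receives the constant `8` before `a` is read, whence `a ≠ R`; the bound `hb`
excludes wrap-around. -/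
theorem runs_laneAddr {w R o a : ℕ} {t : Config} {m : ℕ} {Q : Config → Prop} (ho : o < 8)
    (hw : 8 < 2 ^ w) (ha : a ≠ R) (hb : 8 * t.reg a + 8 ≤ 2 ^ w)
    (h : ∀ t' : Config, t'.reg R = 8 * t.reg a + o → t'.mem = t.mem →
      (∀ r, r ≠ R → r ≠ R + 1 → t'.reg r = t.reg r) → Q t') :
    Runs w (laneAddr R o a) t 4 m Q := by
  refine (Runs.seq (B := 1) (B' := 3) <| Runs.const hw <| Runs.seq (B := 1) (B' := 2) <| Runs.op <|
    Runs.seq (B := 1) (B' := 1) <| Runs.const (by omega) <| Runs.op <| h _ ?_ rfl ?_)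
  · have h1 : (t.reg a * 8) % 2 ^ w = t.reg a * 8 := Nat.mod_eq_of_lt (by omega)
    have h2 : (t.reg a * 8 + o) % 2 ^ w = t.reg a * 8 + o := Nat.mod_eq_of_lt (by omega)
    simp [BinOp.eval, ha, h1, h2, mul_comm 8]
  · intro r h1 h2
    simp [Function.update_apply, h1, h2]

/-- The effect of running in a lane: the registers below `R` and the lane are as after running the
original program, registers from `R + 2` on and the other lanes are unchanged. -/
def LaneRel (R o : ℕ) (t s' t' : Config) : Prop :=
  (∀ r < R, t'.reg r = s'.reg r) ∧ (∀ r, R + 2 ≤ r → t'.reg r = t.reg r) ∧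
  (∀ a, t'.mem (8 * a + o) = s'.mem a) ∧ ∀ b, b % 8 ≠ o → t'.mem b = t.mem b

/-- Induction on the execution. A load or store becomes four address instructions and one access,
which explains the factor `5`. An address `a < m` becomes `8 * a + o < 8 * m`, so the lane
arithmetic never overflows. -/
theorem Exec.inLane {w R o : ℕ} (ho : o < 8) (hw : 8 < 2 ^ w) {p : Prog} {s s' : Config}
    {τ m : ℕ} (h : Exec w p s s' τ m) :
    p.RegBelow R → 8 * m ≤ 2 ^ w → ∀ t : Config, (∀ r < R, t.reg r = s.reg r) →
    (∀ a, t.mem (8 * a + o) = s.mem a) →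
    Runs w (p.inLane R o) t (5 * τ) (8 * m) (LaneRel R o t s') := by
  induction h with
  | skip s =>
    intro _ _ t hr hmem
    exact (Runs.skip (m := 0) (Q := LaneRel R o t s)
      ⟨hr, fun _ _ => rfl, hmem, fun _ _ => rfl⟩).mono (by omega) (by omega) fun _ h => h
  | const s r k =>
    intro hp _ t hr hmem
    refine ⟨_, _, _, .const t r k, by omega, by omega, ?_, ?_, hmem, fun _ _ => rfl⟩
    · intro r' hr'
      simp only [Function.update_apply, hr r' hr']
    · intro r' hr'
      have : r' ≠ r := by simp only [Prog.RegBelow] at hp; omega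
      simp [this]
  | op s f r a b =>
    intro hp _ t hr hmem
    refine ⟨_, _, _, .op t f r a b, by omega, by omega, ?_, ?_, hmem, fun _ _ => rfl⟩
    · intro r' hr'
      simp only [Function.update_apply, hr r' hr', hr a hp.2.1, hr b hp.2.2]
    · intro r' hr'
      have : r' ≠ r := by have := hp.1; omega
      simp [this]
  | load s r a =>
    intro hp hm t hr hmem
    obtain ⟨h1, h2⟩ := hp
    refine (Runs.seq (B := 4) (B' := 1) <| runs_laneAddr ho hw (by omega)
      (by rw [hr a h2]; omega) fun t' e1 e2 e3 => Runs.load ?_ ?_).mono (by omega) le_rfl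
      fun _ h => h
    · rw [e1, hr a h2]; omega
    · refine ⟨?_, ?_, ?_, ?_⟩
      · intro r' hr'
        simp only [Function.update_apply, e1, e2, hr a h2, hmem]
        split_ifs with h
        · rfl
        · rw [e3 r' (by omega) (by omega), hr r' hr']
      · intro r' hr'
        have : r' ≠ r := by omega
        simp only [Function.update_apply, this, if_false]
        exact e3 r' (by omega) (by omega)
      · intro a
        simp only [e2, hmem]
      · intro b _
        simp only [e2]
  | store s a b =>
    intro hp hm t hr hmem
    obtain ⟨h1, h2⟩ := hp
    refine (Runs.seq (B := 4) (B' := 1) <| runs_laneAddr ho hw (by omega)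
      (by rw [hr a h1]; omega) fun t' e1 e2 e3 => Runs.store ?_ ?_).mono (by omega) le_rfl
      fun _ h => h
    · rw [e1, hr a h1]; omega
    · refine ⟨?_, ?_, ?_, ?_⟩
      · intro r' hr'
        exact (e3 r' (by omega) (by omega)).trans (hr r' hr')
      · intro r' hr'
        exact e3 r' (by omega) (by omega)
      · intro a'
        have : t'.reg b = s.reg b := (e3 b (by omega) (by omega)).trans (hr b h2)
        simp only [Function.update_apply, e1, e2, hr a h1, hmem, this]
        split_ifs <;> first | rfl | (exfalso; omega)
      · intro b' hb'
        have : b' ≠ 8 * t.reg a + o := by omega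
        simp only [Function.update_apply, e1, e2, this, if_false]
  | @seq p q s s₁ s₂ τ τ' m m' _ _ ih₁ ih₂ =>
    intro hp hm t hr hmem
    refine (Runs.seq (B := 5 * τ) (B' := 5 * τ') <|
      (ih₁ hp.1 (by have := le_max_left m m'; omega) t hr hmem).mono le_rfl
        (by have := le_max_left m m'; omega) fun t₁ ⟨a1, a2, a3, a4⟩ =>
      (ih₂ hp.2 (by have := le_max_right m m'; omega) t₁ a1 a3).mono le_rfl
        (by have := le_max_right m m'; omega) fun t₂ ⟨b1, b2, b3, b4⟩ => ?_).mono
      (by omega) le_rfl fun _ h => h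
    exact ⟨b1, fun r h => (b2 r h).trans (a2 r h), b3, fun b h => (b4 b h).trans (a4 b h)⟩
  | @ifTrue r p q s s₁ τ m h _ ih =>
    intro hp hm t hr hmem
    obtain ⟨t', τ', m', he, h1, h2, h3⟩ := ih hp.2.1 hm t hr hmem
    exact ⟨t', _, m', .ifTrue (by rwa [hr r hp.1]) he, by omega, h2, h3⟩
  | @ifFalse r p q s s₁ τ m h _ ih =>
    intro hp hm t hr hmem
    obtain ⟨t', τ', m', he, h1, h2, h3⟩ := ih hp.2.2 hm t hr hmem
    exact ⟨t', _, m', .ifFalse (by rwa [hr r hp.1]) he, by omega, h2, h3⟩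
  | @whileDone r p s h =>
    intro hp hm t hr hmem
    exact ⟨t, _, _, .whileDone (by rwa [hr r hp.1]), by omega, by omega, hr, fun _ _ => rfl, hmem,
      fun _ _ => rfl⟩
  | @whileStep r p s s₁ s₂ τ τ' m m' h _ _ ih₁ ih₂ =>
    intro hp hm t hr hmem
    obtain ⟨t₁, τ₁, m₁, he₁, h1, h2, a1, a2, a3, a4⟩ :=
      ih₁ hp.2 (by have := le_max_left m m'; omega) t hr hmem
    obtain ⟨t₂, τ₂, m₂, he₂, h1', h2', b1, b2, b3, b4⟩ :=
      ih₂ hp (by have := le_max_right m m'; omega) t₁ a1 a3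
    refine ⟨t₂, _, _, .whileStep (by rwa [hr r hp.1]) he₁ he₂, by omega, ?_,
      b1, fun r h => (b2 r h).trans (a2 r h), b3, fun b h => (b4 b h).trans (a4 b h)⟩
    have := le_max_left m m'
    have := le_max_right m m'
    exact max_le (by omega) (by omega)

/-! ### A small command language on variables and lanes -/

/-- Commands on variables (numbered by natural numbers) and the eight lanes of the memory. -/
inductive Cmd where
  | const (k c : ℕ)
  | move (k a : ℕ)
  | add (k a b : ℕ)
  | sub (k a b : ℕ)
  | lt (k a b : ℕ)
  | eq (k a b : ℕ)
  | read (o k a : ℕ)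
  | write (o a b : ℕ)
  /-- run a program on lane `o`, with the variables `a` and `b` as arguments; the first three
  results are put into the variables `0`, `1` and `2` -/
  | call (p : Prog) (o a b : ℕ)
  | seq (p q : Cmd)
  | ite (k : ℕ) (p q : Cmd)
  | skip

/-- Set the registers below `k` to `0`. -/
def zeroRegs : ℕ → Prog
  | 0 => .skip
  | k + 1 => .seq (zeroRegs k) (.const k 0)

theorem runs_zeroRegs {w m : ℕ} (k : ℕ) {t : Config} {Q : Config → Prop}
    (h : Q ⟨fun r => if r < k then 0 else t.reg r, t.mem⟩) :
    Runs w (zeroRegs k) t (k + 1) m Q := by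
  induction k generalizing Q with
  | zero => exact Runs.skip (by simpa using h)
  | succ k ih =>
    refine Runs.seq (B := k + 1) (B' := 1) (ih (Runs.const (by positivity) ?_))
    convert h using 2
    funext r
    simp only [Function.update_apply]
    split_ifs <;> first | rfl | omega

/-- Variable `k` is register `R + 2 + k`. -/
def Cmd.compile (R : ℕ) : Cmd → Prog
  | .const k c => .const (R + 2 + k) c
  | .move k a => .op .or (R + 2 + k) (R + 2 + a) (R + 2 + a)
  | .add k a b => .op .add (R + 2 + k) (R + 2 + a) (R + 2 + b)
  | .sub k a b => .op .sub (R + 2 + k) (R + 2 + a) (R + 2 + b)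
  | .lt k a b => .op .lt (R + 2 + k) (R + 2 + a) (R + 2 + b)
  | .eq k a b => .op .eq (R + 2 + k) (R + 2 + a) (R + 2 + b)
  | .read o k a => .seq (laneAddr R o (R + 2 + a)) (.load (R + 2 + k) R)
  | .write o a b => .seq (laneAddr R o (R + 2 + a)) (.store R (R + 2 + b))
  | .call p o a b => .seq (zeroRegs R) <|
      .seq (.op .or 0 (R + 2 + a) (R + 2 + a)) <| .seq (.op .or 1 (R + 2 + b) (R + 2 + b)) <|
      .seq (p.inLane R o) <| .seq (.op .or (R + 2) 0 0) <|
      .seq (.op .or (R + 2 + 1) 1 1) (.op .or (R + 2 + 2) 2 2)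
  | .seq p q => .seq (p.compile R) (q.compile R)
  | .ite k p q => .ifNonzero (R + 2 + k) (p.compile R) (q.compile R)
  | .skip => .skip

/-- The number of steps of a command is at most `cost * N` if called programs need at most
`N` steps. -/
def Cmd.cost (R : ℕ) : Cmd → ℕ
  | .read .. => 5
  | .write .. => 5
  | .call .. => R + 11
  | .seq p q => p.cost R + q.cost R
  | .ite _ p q => p.cost R + q.cost R + 1
  | _ => 1

/-- Side conditions of a command: lanes exist and the called programs use registers below `R`. -/
def Cmd.Valid (R : ℕ) : Cmd → Prop
  | .const _ c => c ≤ 8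
  | .read o _ _ => o < 8
  | .write o _ _ => o < 8
  | .call p o _ _ => o < 8 ∧ p.RegBelow R
  | .seq p q => p.Valid R ∧ q.Valid R
  | .ite _ p q => p.Valid R ∧ q.Valid R
  | _ => True

/-- Weakest precondition of a command, with word size `w`, time bound `N` and space bound `d` for
the called programs, and space bound `8 * m` for the command. The state consists of the variables
`g` and the lanes `L`. -/
def Cmd.wp (w N d m : ℕ) : Cmd → (ℕ → ℕ) → (ℕ → ℕ → ℕ) → ((ℕ → ℕ) → (ℕ → ℕ → ℕ) → Prop) → Prop
  | .const k c, g, L, Q => Q (Function.update g k c) L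
  | .move k a, g, L, Q => Q (Function.update g k (g a)) L
  | .add k a b, g, L, Q => g a + g b < 2 ^ w ∧ Q (Function.update g k (g a + g b)) L
  | .sub k a b, g, L, Q => g b ≤ g a ∧ g a < 2 ^ w ∧ Q (Function.update g k (g a - g b)) L
  | .lt k a b, g, L, Q => Q (Function.update g k (if g a < g b then 1 else 0)) L
  | .eq k a b, g, L, Q => Q (Function.update g k (if g a = g b then 1 else 0)) L
  | .read o k a, g, L, Q => g a < m ∧ Q (Function.update g k (L o (g a))) L
  | .write o a b, g, L, Q =>
      g a < m ∧ Q g (Function.update L o (Function.update (L o) (g a) (g b)))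
  | .call p o a b, g, L, Q => ∃ M' out, Call w p [g a, g b] (L o) M' out N d ∧
      Q (Function.update (Function.update (Function.update g 0 (out 0)) 1 (out 1)) 2 (out 2))
        (Function.update L o M')
  | .seq p q, g, L, Q => p.wp w N d m g L fun g' L' => q.wp w N d m g' L' Q
  | .ite k p q, g, L, Q => (g k ≠ 0 → p.wp w N d m g L Q) ∧ (g k = 0 → q.wp w N d m g L Q)
  | .skip, g, L, Q => Q g L

/-- The configuration `t` represents the variables `g` and the lanes `L`. -/
def Represents (R : ℕ) (t : Config) (g : ℕ → ℕ) (L : ℕ → ℕ → ℕ) : Prop :=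
  (∀ k, t.reg (R + 2 + k) = g k) ∧ ∀ o < 8, ∀ a, t.mem (8 * a + o) = L o a

theorem Represents.update_var {R : ℕ} {t : Config} {g : ℕ → ℕ} {L : ℕ → ℕ → ℕ}
    (h : Represents R t g L) {k x : ℕ} {t' : Config} (hm : t'.mem = t.mem)
    (hx : t'.reg (R + 2 + k) = x) (hr : ∀ r, R + 2 ≤ r → r ≠ R + 2 + k → t'.reg r = t.reg r) :
    Represents R t' (Function.update g k x) L := by
  refine ⟨fun k' => ?_, fun o ho a => by rw [hm]; exact h.2 o ho a⟩
  by_cases hk : k' = k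
  · subst hk; simpa using hx
  · rw [hr _ (by omega) (by omega), Function.update_of_ne hk, h.1]

/-- Induction on the command. The only substantial case is a call, where the simulation in a lane
replaces the original execution; `3 ≤ R` places the argument and result registers `0`, `1`, `2`
among the simulated ones. -/
theorem Cmd.wp_sound {w N d m R : ℕ} (hN : 1 ≤ N) (hR : 3 ≤ R) (hdm : d ≤ m) (hw : 8 * m ≤ 2 ^ w)
    (hw' : 8 < 2 ^ w) (c : Cmd) {g : ℕ → ℕ} {L : ℕ → ℕ → ℕ}
    {Q : (ℕ → ℕ) → (ℕ → ℕ → ℕ) → Prop} (hc : c.Valid R) (h : c.wp w N d m g L Q) (t : Config)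
    (ht : Represents R t g L) :
    Runs w (c.compile R) t (c.cost R * N) (8 * m)
      fun t' => ∃ g' L', Represents R t' g' L' ∧ Q g' L' := by
  induction c generalizing g L Q t with
  | const k c =>
    have : c ≤ 8 := hc
    refine (Runs.const (by omega) ⟨_, _, ht.update_var (k := k) rfl ?_ ?_, h⟩).mono
      (by simpa [Cmd.cost] using hN) le_rfl fun _ h => h
    · simp
    · intro r _ hr; simp [hr]
  | move k a =>
    refine (Runs.move ⟨_, _, ht.update_var (k := k) rfl ?_ ?_, h⟩).mono
      (by simpa [Cmd.cost] using hN) le_rfl fun _ h => h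
    · simp [ht.1]
    · intro r _ hr; simp [hr]
  | add k a b =>
    refine (Runs.op ⟨_, _, ht.update_var (k := k) rfl ?_ ?_, h.2⟩).mono
      (by simpa [Cmd.cost] using hN) le_rfl fun _ h => h
    · simp [ht.1, BinOp.eval, Nat.mod_eq_of_lt h.1]
    · intro r _ hr; simp [hr]
  | sub k a b =>
    refine (Runs.op ⟨_, _, ht.update_var (k := k) rfl ?_ ?_, h.2.2⟩).mono
      (by simpa [Cmd.cost] using hN) le_rfl fun _ h => h
    · obtain ⟨h1, h2, -⟩ := h
      have : g a + (2 ^ w - g b) = g a - g b + 2 ^ w := by omega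
      simp only [ht.1, BinOp.eval, Function.update_self, this, Nat.add_mod_right]
      exact Nat.mod_eq_of_lt (by omega)
    · intro r _ hr; simp [hr]
  | lt k a b =>
    refine (Runs.op ⟨_, _, ht.update_var (k := k) rfl ?_ ?_, h⟩).mono
      (by simpa [Cmd.cost] using hN) le_rfl fun _ h => h
    · simp [ht.1, BinOp.eval]
    · intro r _ hr; simp [hr]
  | eq k a b =>
    refine (Runs.op ⟨_, _, ht.update_var (k := k) rfl ?_ ?_, h⟩).mono
      (by simpa [Cmd.cost] using hN) le_rfl fun _ h => h
    · simp [ht.1, BinOp.eval]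
    · intro r _ hr; simp [hr]
  | read o k a =>
    obtain ⟨h1, h2⟩ := h
    have ho : o < 8 := hc
    refine (Runs.seq (B := 4) (B' := 1) <| runs_laneAddr ho hw' (by omega)
      (by rw [ht.1]; omega) fun t' e1 e2 e3 => Runs.load ?_
      ⟨_, _, ht.update_var (k := k) e2 ?_ ?_, h2⟩).mono (by simp only [Cmd.cost]; omega) le_rfl
      fun _ h => h
    · rw [e1, ht.1]; omega
    · simp only [Function.update_self, e1, e2, ht.1, ht.2 o ho]
    · intro r _ hr
      simp only [ne_eq, hr, not_false_eq_true, Function.update_of_ne]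
      exact e3 r (by omega) (by omega)
  | write o a b =>
    obtain ⟨h1, h2⟩ := h
    have ho : o < 8 := hc
    refine (Runs.seq (B := 4) (B' := 1) <| runs_laneAddr ho hw' (by omega)
      (by rw [ht.1]; omega) fun t' e1 e2 e3 => Runs.store ?_
      ⟨_, _, ⟨?_, ?_⟩, h2⟩).mono (by simp only [Cmd.cost]; omega) le_rfl
      fun _ h => h
    · rw [e1, ht.1]; omega
    · intro k
      exact (e3 _ (by omega) (by omega)).trans (ht.1 k)
    · intro o' ho' a'
      have hb : t'.reg (R + 2 + b) = g b := (e3 _ (by omega) (by omega)).trans (ht.1 b)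
      simp only [Function.update_apply, e1, e2, ht.1, hb]
      by_cases ho'' : o' = o
      · subst ho''
        by_cases ha : a' = g a
        · simp [ha]
        · have : 8 * a' + o' ≠ 8 * g a + o' := by omega
          simp [ha, ht.2 _ ho']
      · have : 8 * a' + o' ≠ 8 * g a + o := by omega
        simp [ho'', this, ht.2 _ ho']
  | call p o a b =>
    obtain ⟨M', out, ⟨τ, m₀, he, hτ, hm₀⟩, hQ⟩ := h
    obtain ⟨ho, hp⟩ := hc
    have hτ' : τ ≤ N := by exact_mod_cast hτ
    -- After zeroing and passing arguments, the registers below `R` agree with the initial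
    -- configuration required by `Call`, whatever earlier calls left behind.
    set t₁ : Config := ⟨Function.update (Function.update (fun r => if r < R then 0 else t.reg r)
      0 (g a)) 1 (g b), t.mem⟩ with ht₁
    have hsim := he.inLane ho hw' hp (by omega) t₁ (fun r hr => by
      simp only [ht₁, Function.update_apply, hr, if_true]
      rcases r with _ | _ | r <;> simp) (fun a => ht.2 o ho a)
    have key : Runs w ((Cmd.call p o a b).compile R) t
        (R + 1 + (1 + (1 + (5 * τ + (1 + (1 + 1)))))) (8 * m)
        fun t' => ∃ g' L', Represents R t' g' L' ∧ Q g' L' := by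
      refine Runs.seq <| runs_zeroRegs R <| Runs.seq <| Runs.move <| Runs.seq <| Runs.move <|
        Runs.seq ?_
      have e : (⟨Function.update (Function.update (fun r => if r < R then 0 else t.reg r)
          0 (if R + 2 + a < R then 0 else t.reg (R + 2 + a))) 1
          (Function.update (fun r => if r < R then 0 else t.reg r)
          0 (if R + 2 + a < R then 0 else t.reg (R + 2 + a)) (R + 2 + b)), t.mem⟩ : Config) = t₁ := by
        rw [ht₁]
        have h1 : ¬ R + 2 + a < R := by omega
        have h2 : ¬ R + 2 + b < R := by omega
        simp [h1, h2, ht.1]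
      simp only [e]
      refine hsim.mono le_rfl (by omega) fun t₂ ⟨a1, a2, a3, a4⟩ => ?_
      refine Runs.seq <| Runs.move <| Runs.seq <| Runs.move <| Runs.move ⟨_, _, ⟨?_, ?_⟩, hQ⟩
      · intro k
        have b0 := a1 0 (by omega)
        have b1 := a1 1 (by omega)
        have b2 := a1 2 (by omega)
        have n3 : R ≠ 0 := by omega
        by_cases k0 : k = 0
        · subst k0; simp [b0]
        by_cases k1 : k = 1
        · subst k1; simp [b1]
        by_cases k2 : k = 2
        · subst k2; simp [n3, b2]
        have b3 := a2 (R + 2 + k) (by omega)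
        have m1 : R + 2 + k ≠ 0 := by omega
        have m2 : R + 2 + k ≠ 1 := by omega
        have m3 : ¬ R + 2 + k < R := by omega
        have m4 : R + 2 + k ≠ R + 2 := by omega
        have m5 : R + 2 + k ≠ R + 2 + 1 := by omega
        have m6 : R + 2 + k ≠ R + 2 + 2 := by omega
        simp only [Function.update_apply, m4, m5, m6, k0, k1, k2, if_false, b3, ht₁, m1, m2, m3,
          ht.1]
      · intro o' ho' a'
        by_cases h : o' = o
        · subst h; simpa using a3 a'
        · rw [Function.update_of_ne h, ← ht.2 o' ho' a']
          exact a4 _ (by omega)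
    refine key.mono ?_ le_rfl fun _ h => h
    simp only [Cmd.cost]
    nlinarith
  | seq p q ihp ihq =>
    refine (Runs.seq (B := p.cost R * N) (B' := q.cost R * N) ?_).mono
      (by simp only [Cmd.cost]; linarith) le_rfl fun _ h => h
    exact (ihp hc.1 h t ht).mono le_rfl le_rfl fun t' ⟨g', L', h1, h2⟩ => ihq hc.2 h2 t' h1
  | ite k p q ihp ihq =>
    refine (Runs.ifNonzero (B := (p.cost R + q.cost R) * N) (fun hk => ?_) fun hk => ?_).mono
      (by simp only [Cmd.cost]; linarith) le_rfl fun _ h => h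
    · exact (ihp hc.1 (h.1 (by rwa [← ht.1])) t ht).mono (by nlinarith) le_rfl fun _ h => h
    · exact (ihq hc.2 (h.2 (by rwa [← ht.1])) t ht).mono (by nlinarith) le_rfl fun _ h => h
  | skip =>
    exact (Runs.skip ⟨_, _, ht, h⟩).mono (by simpa [Cmd.cost] using hN) le_rfl fun _ h => h

/-! ### Combinatorics of suffix trees -/

/-- `v` is the highest node of the suffix tree of `S` at or below the position of `u`. -/
def Locus (S u v : List ℕ) : Prop :=
  IsNode S v ∧ u <+: v ∧ ∀ v', IsNode S v' → u <+: v' → v <+: v'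

theorem IsNode.infix {S u : List ℕ} (h : IsNode S u) : u <:+: S := by
  rcases h with h | ⟨a, _, _, h, _⟩
  · exact h.isInfix
  · exact (List.prefix_append u [a]).isInfix.trans h

theorem isNode_nil (S : List ℕ) : IsNode S [] := .inl (List.nil_suffix)

theorem isNode_self (S : List ℕ) : IsNode S S := .inl (List.suffix_rfl)

theorem IsNode.of_suffix {S S' u : List ℕ} (hS : S <:+ S') (h : IsNode S u) : IsNode S' u := by
  rcases h with h | ⟨a, b, hab, ha, hb⟩
  · exact .inl (h.trans hS)
  · exact .inr ⟨a, b, hab, ha.trans hS.isInfix, hb.trans hS.isInfix⟩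

/-- Two lists that are not prefixes of each other branch after a common prefix. -/
theorem exists_branching : ∀ {v v' : List ℕ}, ¬ v <+: v' → ¬ v' <+: v →
    ∃ p a b, a ≠ b ∧ p ++ [a] <+: v ∧ p ++ [b] <+: v'
  | [], _, h, _ => absurd List.nil_prefix h
  | _ :: _, [], _, h => absurd List.nil_prefix h
  | x :: v, y :: v', h, h' => by
    by_cases hxy : x = y
    · subst hxy
      simp only [List.cons_prefix_cons, true_and] at h h'
      obtain ⟨p, a, b, hab, h1, h2⟩ := exists_branching h h'
      exact ⟨x :: p, a, b, hab, by simpa using h1, by simpa using h2⟩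
    · exact ⟨[], x, y, hxy, by simp, by simp⟩

theorem exists_append_singleton_prefix {p v : List ℕ} (h : p <+: v) (hne : p ≠ v) :
    ∃ a, p ++ [a] <+: v := by
  obtain ⟨t, rfl⟩ := h
  cases t with
  | nil => simp at hne
  | cons a t => exact ⟨a, t, by simp⟩

theorem append_singleton_inj {p v : List ℕ} {a b : ℕ} (ha : p ++ [a] <+: v)
    (hb : p ++ [b] <+: v) : a = b := by
  have := (List.prefix_of_prefix_length_le ha hb (by simp)).eq_of_length (by simp)
  simpa using this

/-- Take a shortest node `v` with prefix `u`. A node below `u` but not below `v` would branch off at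
a node `p`. If `p` is at least as long as `u`, it contradicts minimality; if it is shorter, both
branching letters lie inside `u` and coincide. -/
theorem exists_locus {S u : List ℕ} (h : u <:+: S) : ∃ v, Locus S u v := by
  classical
  have hex : ∃ k v, IsNode S v ∧ u <+: v ∧ v.length = k := by
    obtain ⟨s, t, rfl⟩ := h
    -- An occurrence of `u` prolonged to the end of the string is a suffix, hence a node.
    exact ⟨_, u ++ t, .inl ⟨s, by simp⟩, List.prefix_append _ _, rfl⟩
  obtain ⟨v, hv, huv, hlen⟩ := Nat.find_spec hex
  refine ⟨v, hv, huv, fun v' hv' huv' => ?_⟩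
  have hmin : ∀ y, IsNode S y → u <+: y → v.length ≤ y.length := fun y hy hy' => by
    rw [hlen]
    exact Nat.find_min' hex ⟨y, hy, hy', rfl⟩
  by_contra hvv'
  by_cases hv'v : v' <+: v
  · exact hvv' (hv'v.eq_of_length_le (hmin v' hv' huv') ▸ List.prefix_rfl)
  · obtain ⟨p, a, b, hab, ha, hb⟩ := exists_branching hvv' hv'v
    have hp : IsNode S p := .inr ⟨a, b, hab, ha.isInfix.trans hv.infix, hb.isInfix.trans hv'.infix⟩
    have hpv : p.length < v.length := by simpa using ha.length_le
    by_cases hup : u.length ≤ p.length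
    · have := hmin p hp (List.prefix_of_prefix_length_le huv
        ((List.prefix_append p [a]).trans ha) hup)
      omega
    · have h1 : p ++ [a] <+: u := List.prefix_of_prefix_length_le ha huv (by simp; omega)
      exact hab (append_singleton_inj (h1.trans huv') hb)

/-- The longest node that is a proper prefix of `v` is the parent of `v`. -/
theorem isChild_of_forall {S u v : List ℕ} (hu : IsNode S u) (hv : IsNode S v) (huv : u <+: v)
    (hne : u ≠ v) (h : ∀ y, IsNode S y → y <+: v → y ≠ v → y.length ≤ u.length) :
    ∃ c, u ++ [c] <+: v ∧ IsChild S u c v := by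
  obtain ⟨c, hc⟩ := exists_append_singleton_prefix huv hne
  obtain ⟨y, hy⟩ := exists_locus (hc.isInfix.trans hv.infix)
  have hyv := hy.2.2 v hv hc
  have : y = v := by
    by_contra hne'
    have h1 := h y hy.1 hyv hne'
    have h2 := hy.2.1.length_le
    simp at h2
    omega
  exact ⟨c, hc, hu, this ▸ hy⟩

theorem exists_parent {S v : List ℕ} (hv : IsNode S v) (hne : v ≠ []) :
    ∃ u c, u ++ [c] <+: v ∧ IsChild S u c v := by
  classical
  have hP : ∃ k ≤ v.length, ∃ y, IsNode S y ∧ y <+: v ∧ y ≠ v ∧ y.length = k :=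
    ⟨0, by omega, [], isNode_nil S, List.nil_prefix, hne.symm, rfl⟩
  obtain ⟨k₀, hk₀, hk⟩ := hP
  obtain ⟨u, hu, huv, hne', hlen⟩ := Nat.findGreatest_spec
    (P := fun k => ∃ y, IsNode S y ∧ y <+: v ∧ y ≠ v ∧ y.length = k) hk₀ hk
  refine ⟨u, isChild_of_forall hu hv huv hne' fun y hy hyv hy' => ?_⟩
  rw [hlen]
  exact Nat.le_findGreatest hyv.length_le ⟨y, hy, hyv, hy', rfl⟩

theorem IsChild.le_of_node {S u v y : List ℕ} {c : ℕ} (h : IsChild S u c v) (hy : IsNode S y)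
    (hyv : y <+: v) (hne : y ≠ v) : y.length ≤ u.length := by
  by_contra! hlt
  have h1 : u ++ [c] <+: y := List.prefix_of_prefix_length_le h.2.2.1 hyv (by simp; omega)
  exact hne (hyv.eq_of_length_le (h.2.2.2 y hy h1).length_le)

/-! ### Adding a letter in front of a string -/

/-- A new internal node of the suffix tree of `a :: S` is a prefix of `a :: S` that occurs in `S`,
while the prefix that is longer by one letter does not occur in `S`. -/
theorem new_node {a : ℕ} {S u : List ℕ} (h : IsNode (a :: S) u) (h' : ¬ IsNode S u)
    (hne : u ≠ a :: S) : u <:+: S ∧ ∃ b, u ++ [b] <+: a :: S ∧ ¬ u ++ [b] <:+: S := by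
  rcases h with h | ⟨b, c, hbc, hb, hc⟩
  · rcases List.suffix_cons_iff.1 h with h | h
    · exact absurd h hne
    · exact absurd (.inl h) h'
  · rcases List.infix_cons_iff.1 hb with hb' | hb' <;> rcases List.infix_cons_iff.1 hc with hc' | hc'
    · exact absurd (append_singleton_inj hb' hc') hbc
    · exact ⟨(List.prefix_append u [c]).isInfix.trans hc', b, hb',
        fun hb'' => h' (.inr ⟨b, c, hbc, hb'', hc'⟩)⟩
    · exact ⟨(List.prefix_append u [b]).isInfix.trans hb', c, hc',
        fun hc'' => h' (.inr ⟨b, c, hbc, hb', hc''⟩)⟩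
    · exact absurd (.inr ⟨b, c, hbc, hb', hc'⟩) h'

/-- Each new internal node is the longest prefix of `a :: S` that occurs in `S`: of two distinct
ones, the longer would contain the one-letter extension of the shorter, which does not occur in `S`.
-/
theorem new_node_unique {a : ℕ} {S u v : List ℕ} (hu : IsNode (a :: S) u) (hu' : ¬ IsNode S u)
    (hun : u ≠ a :: S) (hv : IsNode (a :: S) v) (hv' : ¬ IsNode S v) (hvn : v ≠ a :: S) :
    u = v := by
  obtain ⟨hu1, b, hub, hub'⟩ := new_node hu hu' hun
  obtain ⟨hv1, c, hvc, hvc'⟩ := new_node hv hv' hvn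
  have hup := (List.prefix_append u [b]).trans hub
  have hvp := (List.prefix_append v [c]).trans hvc
  rcases lt_trichotomy u.length v.length with hlt | heq | hlt
  · exact absurd ((List.prefix_of_prefix_length_le hub hvp (by simp; omega)).isInfix.trans hv1) hub'
  · exact (List.prefix_of_prefix_length_le hup hvp heq.le).eq_of_length heq
  · exact absurd ((List.prefix_of_prefix_length_le hvc hup (by simp; omega)).isInfix.trans hu1) hvc'

/-- The parent of the new leaf is the only node that may be new besides the leaf. -/
theorem parent_leaf {a : ℕ} {S u : List ℕ} {c : ℕ} (h : IsChild (a :: S) u c (a :: S))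
    {v : List ℕ} (hv : IsNode (a :: S) v) (hv' : ¬ IsNode S v) (hne : v ≠ a :: S) : v = u := by
  obtain ⟨h1, b, hb, hb'⟩ := new_node hv hv' hne
  have hvp := (List.prefix_append v [b]).trans hb
  have hle := h.le_of_node hv hvp hne
  have hup := (List.prefix_append u [c]).trans h.2.2.1
  refine (List.prefix_of_prefix_length_le hvp hup hle).eq_of_length_le ?_
  -- If `v` were shorter than `u`, then `u` would contain `v ++ [b]`, which is absent from `S`. So
  -- `u` would be a second new internal node.
  by_contra! hlt
  have hvu : v ++ [b] <+: u := List.prefix_of_prefix_length_le hb hup (by simp; omega)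
  have hun : u ≠ a :: S := by
    rintro rfl
    have := h.2.2.1.length_le
    simp at this
  have hu : IsNode S u → False := fun hu => hb' (hvu.isInfix.trans hu.infix)
  exact hlt.ne (by rw [new_node_unique h.1 hu hun hv hv' hne])

/-- After a letter is added in front of the string, the locus of a string is the old locus or
its parent. -/
theorem Locus.cons {a : ℕ} {S F v y : List ℕ} {c : ℕ} (h : Locus S F v)
    (hy : IsChild (a :: S) y c v) :
    (F.length ≤ y.length → Locus (a :: S) F y) ∧ (y.length < F.length → Locus (a :: S) F v) := by
  have hv : IsNode (a :: S) v := h.1.of_suffix (List.suffix_cons a S)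
  obtain ⟨v', hv'⟩ := exists_locus (h.2.1.isInfix.trans hv.infix)
  have hv'v : v' <+: v := hv'.2.2 v hv h.2.1
  have hyv : y <+: v := (List.prefix_append y [c]).trans hy.2.2.1
  have hyne : y ≠ v := by
    rintro rfl
    have := hy.2.2.1.length_le
    simp at this
  -- A node strictly above `v` and still below `F` is new, because `v` was the highest old one, and
  -- it is too short to be the leaf. By uniqueness there is only one candidate.
  have key : ∀ z, IsNode (a :: S) z → F <+: z → z <+: v → z ≠ v → ¬ IsNode S z ∧ z ≠ a :: S := by
    intro z _ hFz hzv hne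
    refine ⟨fun hz' => hne (hzv.eq_of_length_le (h.2.2 z hz' hFz).length_le), ?_⟩
    rintro rfl
    have h1 := hzv.length_le
    have h2 := h.1.infix.length_le
    simp at h1
    omega
  constructor
  · intro hle
    have hFy : F <+: y := List.prefix_of_prefix_length_le h.2.1 hyv hle
    have hne : v' ≠ v := by
      rintro rfl
      exact hyne (hyv.eq_of_length_le (hv'.2.2 y hy.1 hFy).length_le)
    obtain ⟨a1, a2⟩ := key y hy.1 hFy hyv hyne
    obtain ⟨b1, b2⟩ := key v' hv'.1 hv'.2.1 hv'v hne
    rwa [new_node_unique hy.1 a1 a2 hv'.1 b1 b2]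
  · intro hlt
    have : v' = v := by
      by_contra hne
      have h1 := hy.le_of_node hv'.1 hv'v hne
      have h2 := hv'.2.1.length_le
      omega
    rwa [← this]

/-- If the parent `u` of the new leaf is a new node, then in the old suffix tree it lies on the edge
from its new parent `x` to the child of `x` in direction of `u`. -/
theorem old_child {a : ℕ} {S u x : List ℕ} {c : ℕ} (hu' : ¬ IsNode S u) (hun : u ≠ a :: S)
    (hx : IsChild (a :: S) x c u) : ∃ v, IsChild S x c v ∧ Locus S u v := by
  have hu : IsNode (a :: S) u := hx.2.1
  obtain ⟨huS, b, hb, -⟩ := new_node hu hu' hun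
  have hxlt : x.length < u.length := by simpa using hx.2.2.1.length_le
  have hxS : IsNode S x := by
    -- The parent `x` is an old node, for otherwise `x` and `u` would be two new internal nodes.
    by_contra hxS
    have hxn : x ≠ a :: S := by
      rintro rfl
      have h1 := huS.length_le
      simp at hxlt
      omega
    exact hxlt.ne (by rw [new_node_unique hx.1 hxS hxn hu hu' hun])
  obtain ⟨v, hv⟩ := exists_locus (hx.2.2.1.isInfix.trans huS)
  have huv : u <+: v := hx.2.2.2 v (hv.1.of_suffix (List.suffix_cons a S)) hv.2.1
  exact ⟨v, ⟨hxS, hv⟩, hv.1, huv, fun v' hv' h' => hv.2.2 v' hv' (hx.2.2.1.trans h')⟩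

/-- Extending a string by a letter at its locus. -/
theorem Locus.append {S F v : List ℕ} {c : ℕ} (h : Locus S F v)
    (hc : F ++ [c] <+: v) : Locus S (F ++ [c]) v :=
  ⟨h.1, hc, fun v' hv' h' => h.2.2 v' hv' ((List.prefix_append F [c]).trans h')⟩

/-- Strictly inside an edge only one letter can follow. An occurrence of `F ++ [c]` prolonged to a
suffix is a node below `F`, hence below `v`, so `v` itself continues `F` with `c`. -/
theorem Locus.prefix_of_infix {S F v : List ℕ} {c : ℕ} (h : Locus S F v) (hF : F ≠ v)
    (hc : F ++ [c] <:+: S) : F ++ [c] <+: v := by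
  obtain ⟨s, t, rfl⟩ := hc
  have h1 := h.2.2 (F ++ [c] ++ t) (.inl ⟨s, by simp⟩) ⟨[c] ++ t, by simp⟩
  obtain ⟨d, hd⟩ := exists_append_singleton_prefix h.2.1 hF
  have : d = c := append_singleton_inj (hd.trans h1) (List.prefix_append _ _)
  rwa [← this]

/-! ### First occurrences -/

/-- The inverted prefix of length `i` of the text. -/
def revPrefix (T : List ℕ) (i : ℕ) : List ℕ := (T.take i).reverse

/-- The first occurrence of the inversion of `u` in `T` ends at position `j` (and `j` is
positive). -/
def FirstOcc (T u : List ℕ) (j : ℕ) : Prop :=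
  1 ≤ j ∧ u <+: revPrefix T j ∧ ∀ k, 1 ≤ k → k < j → ¬ u <+: revPrefix T k

theorem revPrefix_succ {T : List ℕ} {i : ℕ} (hi : i < T.length) :
    revPrefix T (i + 1) = T[i] :: revPrefix T i := by
  rw [revPrefix, List.take_succ_eq_append_getElem hi, List.reverse_append]
  rfl

theorem length_revPrefix {T : List ℕ} {i : ℕ} (hi : i ≤ T.length) : (revPrefix T i).length = i := by
  simp [revPrefix, hi]

theorem revPrefix_suffix {T : List ℕ} {i j : ℕ} (h : i ≤ j) : revPrefix T i <:+ revPrefix T j :=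
  List.reverse_suffix.2 (List.take_prefix_take_left h)

theorem isNode_revPrefix {T : List ℕ} {i j : ℕ} (h : i ≤ j) :
    IsNode (revPrefix T j) (revPrefix T i) :=
  .inl (revPrefix_suffix h)

/-- If the inverted prefix is `s ++ u ++ t`, then `u ++ t` is the inverted prefix of its own length.
The empty `u` is separate because `u ++ t` may then be empty, while `j` has to be positive. -/
theorem exists_revPrefix {T u : List ℕ} {i : ℕ} (hi : 1 ≤ i) (h : u <:+: revPrefix T i) :
    ∃ j, 1 ≤ j ∧ j ≤ i ∧ u <+: revPrefix T j := by
  by_cases hu : u = []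
  · exact ⟨1, le_rfl, hi, hu ▸ List.nil_prefix⟩
  obtain ⟨s, t, ht⟩ := h
  have ht' := congrArg List.reverse ht
  simp only [revPrefix, List.reverse_append, List.reverse_reverse] at ht'
  have hlen := congrArg List.length ht'
  have hu' := List.length_pos_iff.2 hu
  simp only [List.length_append, List.length_reverse, List.length_take] at hlen
  have hp : (u ++ t).reverse <+: T := by
    refine List.IsPrefix.trans ⟨s.reverse, ?_⟩ (List.take_prefix i T)
    rw [List.reverse_append, List.append_assoc]
    exact ht'
  refine ⟨(u ++ t).length, by simp; omega, by simp; omega, ?_⟩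
  have h2 := List.prefix_iff_eq_take.1 hp
  simp only [List.length_reverse] at h2
  rw [revPrefix, ← h2, List.reverse_reverse]
  exact List.prefix_append u t

theorem FirstOcc.le {T u : List ℕ} {i j : ℕ} (h : FirstOcc T u j) (hi : 1 ≤ i)
    (hu : u <:+: revPrefix T i) : j ≤ i := by
  obtain ⟨k, hk1, hk2, hk3⟩ := exists_revPrefix hi hu
  by_contra! hlt
  exact h.2.2 k hk1 (by omega) hk3

/-- With `k = s - 1` this is the test that excludes self-references. The empty string is excluded
because it occurs already for `k = 0`, whereas its first occurrence is `1`. -/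
theorem FirstOcc.infix_iff {T u : List ℕ} {k j : ℕ} (h : FirstOcc T u j) (hu : u ≠ []) :
    u.reverse <:+: T.take k ↔ j ≤ k := by
  rw [← List.reverse_infix, List.reverse_reverse]
  refine ⟨fun hk => h.le ?_ hk, fun hji => h.2.1.isInfix.trans (revPrefix_suffix hji).isInfix⟩
  by_contra hk0
  obtain rfl : k = 0 := by omega
  simp at hk
  exact hu hk

theorem firstOcc_nil (T : List ℕ) : FirstOcc T [] 1 :=
  ⟨le_rfl, List.nil_prefix, fun k h1 h2 => by omega⟩

theorem firstOcc_revPrefix {T : List ℕ} {i : ℕ} (h1 : 1 ≤ i) (hi : i ≤ T.length) :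
    FirstOcc T (revPrefix T i) i := by
  refine ⟨h1, List.prefix_rfl, fun k _ hk h => ?_⟩
  have := h.length_le
  rw [length_revPrefix hi, length_revPrefix (by omega)] at this
  omega

/-- A string has the same first occurrence as its locus. -/
theorem Locus.firstOcc {T F v : List ℕ} {i j : ℕ} (h : Locus (revPrefix T i) F v) (hi : 1 ≤ i)
    (hj : FirstOcc T v j) : FirstOcc T F j := by
  have hji := hj.le hi h.1.infix
  refine ⟨hj.1, h.2.1.trans hj.2.1, fun k hk1 hk2 hk => hj.2.2 k hk1 hk2 ?_⟩
  -- The inverted prefix of length `k` is itself a node, so it starts with the locus as soon as it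
  -- starts with `F`.
  exact h.2.2 _ (isNode_revPrefix (by omega)) hk

theorem getElem_of_prefix_revPrefix {T v : List ℕ} {j k : ℕ} (h : v <+: revPrefix T j)
    (hj : j ≤ T.length) (hk : k < v.length) : ∃ h' : j - k - 1 < T.length,
      k < j ∧ v[k] = T[j - k - 1] := by
  have h1 := h.length_le
  rw [length_revPrefix hj] at h1
  refine ⟨by omega, by omega, ?_⟩
  rw [h.getElem hk]
  simp only [revPrefix, List.getElem_reverse, List.length_take, List.getElem_take]
  congr 1
  omega

/-! ### Extending the factorization by a letter -/

theorem IsRevLZ.ne_nil {T : List ℕ} {fs : List (List ℕ)} (h : IsRevLZ T fs) {F : List ℕ}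
    (hF : F ∈ fs) : F ≠ [] := by
  obtain ⟨x, hx, rfl⟩ := List.mem_iff_getElem.1 hF
  rcases h.2 x hx with ⟨a, ha, -⟩ | ⟨ha, -⟩
  · simp [ha]
  · exact ha

theorem reverse_infix_of_prefix {G G' P : List ℕ} (h : G' <+: G) (hG : G.reverse <:+: P) :
    G'.reverse <:+: P :=
  (List.reverse_suffix.2 h).isInfix.trans hG

/-- A factor that is followed by another factor stays maximal when the text is extended. -/
theorem maximal_of_append {f P Y Z : List ℕ} (hY : Y ≠ [])
    (h : ∀ G, G <+: f ++ Y → G.reverse <:+: P → G.length ≤ f.length) :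
    ∀ G, G <+: f ++ Y ++ Z → G.reverse <:+: P → G.length ≤ f.length := by
  intro G hG hP
  by_contra! hlt
  have hY' : 1 ≤ Y.length := List.length_pos_iff.2 hY
  have h1 : G.take (f.length + 1) <+: f ++ Y :=
    List.prefix_of_prefix_length_le ((List.take_prefix _ _).trans hG) (List.prefix_append _ _)
      (by simp; omega)
  have h2 := h _ h1 (reverse_infix_of_prefix (List.take_prefix _ _) hP)
  simp at h2
  omega

/-- Earlier factors were already followed by the nonempty `F`, so `maximal_of_append` applies to
them. The last factor is all of the remaining text and therefore trivially maximal. -/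
theorem IsRevLZ.extend {T : List ℕ} {gs : List (List ℕ)} {F : List ℕ} {c : ℕ}
    (h : IsRevLZ T (gs ++ [F])) (hc : (F ++ [c]).reverse <:+: gs.flatten) :
    IsRevLZ (T ++ [c]) (gs ++ [F ++ [c]]) := by
  have hF : F ≠ [] := h.ne_nil (by simp)
  refine ⟨by rw [← h.1]; simp, fun x hx => ?_⟩
  have hx' : x < gs.length + 1 := by simpa using hx
  rcases Nat.lt_succ_iff_lt_or_eq.1 hx' with hlt | rfl
  · have h1 := h.2 x (by simp; omega)
    have ht : ∀ G : List ℕ, (gs ++ [G]).take x = gs.take x := fun G =>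
      List.take_append_of_le_length hlt.le
    have hg : ∀ (G : List ℕ) (h' : x < (gs ++ [G]).length), (gs ++ [G])[x] = gs[x] := fun G h' =>
      List.getElem_append_left hlt
    have hd : ∀ G : List ℕ, ((gs ++ [G]).drop x).flatten
        = gs[x] ++ ((gs.drop (x + 1)).flatten ++ G) := by
      intro G
      rw [List.drop_append_of_le_length hlt.le, List.drop_eq_getElem_cons hlt, List.cons_append,
        List.flatten_cons, List.flatten_append, List.flatten_singleton]
    simp only [ht, hg, hd] at h1 ⊢
    refine h1.imp_right fun ⟨a, b, m⟩ => ⟨a, b, ?_⟩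
    have := maximal_of_append (Z := [c]) (by simp [hF]) m
    simpa using this
  · right
    simp only [List.getElem_concat_length, List.take_left, List.drop_left]
    refine ⟨by simp, hc, fun G hG _ => ?_⟩
    have := hG.length_le
    simpa using this

/-- Only the last old factor can lose its maximality, since no text followed it; `hc` excludes
precisely its extension by `c`. Quantifying over decompositions of `gs` lets the empty factorization
satisfy `hc` vacuously. -/
theorem IsRevLZ.next {T : List ℕ} {gs : List (List ℕ)} {c : ℕ} (h : IsRevLZ T gs)
    (hc : ∀ gs' F, gs = gs' ++ [F] → ¬ (F ++ [c]).reverse <:+: gs'.flatten) :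
    IsRevLZ (T ++ [c]) (gs ++ [[c]]) := by
  refine ⟨by rw [← h.1]; simp, fun x hx => ?_⟩
  have hx' : x < gs.length + 1 := by simpa using hx
  rcases Nat.lt_succ_iff_lt_or_eq.1 hx' with hlt | rfl
  · have h1 := h.2 x hlt
    have ht : (gs ++ [[c]]).take x = gs.take x := List.take_append_of_le_length hlt.le
    have hg : ∀ (h' : x < (gs ++ [[c]]).length), (gs ++ [[c]])[x] = gs[x] := fun h' =>
      List.getElem_append_left hlt
    have hd' : (gs.drop x).flatten = gs[x] ++ (gs.drop (x + 1)).flatten := by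
      rw [List.drop_eq_getElem_cons hlt, List.flatten_cons]
    have hd : ((gs ++ [[c]]).drop x).flatten = gs[x] ++ (gs.drop (x + 1)).flatten ++ [c] := by
      rw [List.drop_append_of_le_length hlt.le, List.flatten_append, hd']
      simp
    simp only [ht, hg, hd] at h1 ⊢
    simp only [hd'] at h1
    refine h1.imp_right fun ⟨a, b, m⟩ => ⟨a, b, ?_⟩
    by_cases hl : x + 1 = gs.length
    · have hgs : gs = gs.take x ++ [gs[x]] := by
        rw [List.take_append_getElem, hl, List.take_length]
      have hno := hc _ _ hgs
      intro G hG hP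
      by_contra! hlen
      apply hno
      have h0 : gs.drop (x + 1) = [] := List.drop_eq_nil_of_le hl.ge
      rw [h0, List.flatten_nil, List.append_nil] at hG
      have : G = gs[x] ++ [c] := hG.eq_of_length_le (by simp; omega)
      rwa [← this]
    · refine maximal_of_append (Z := [c]) ?_ m
      have hlt' : x + 1 < gs.length := by omega
      rw [List.drop_eq_getElem_cons hlt', List.flatten_cons]
      exact List.append_ne_nil_of_left_ne_nil (h.ne_nil (List.getElem_mem hlt')) _
  · simp only [List.getElem_concat_length, List.take_left, List.drop_left]
    by_cases hm : c ∈ gs.flatten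
    · right
      refine ⟨by simp, by simpa [List.singleton_infix_iff] using hm, fun G hG _ => ?_⟩
      simpa using hG.length_le
    · exact .inl ⟨c, rfl, hm⟩

theorem isRevLZ_nil : IsRevLZ [] [] :=
  ⟨rfl, fun x hx => absurd hx (Nat.not_lt_zero x)⟩

/-! ### Table of first occurrences -/

/-- The entry of the table `f` at the pointer of a node of the suffix tree of the inverted prefix of
length `i` is the first occurrence of the node; entries for nodes that are inserted later are
`0`. -/
def TableInv (T : List ℕ) (h : List ℕ → ℕ) (i : ℕ) (f : ℕ → ℕ) : Prop :=
  (1 ≤ i → ∀ u, IsNode (revPrefix T i) u → FirstOcc T u (f (h u))) ∧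
  ∀ u, IsNode (revPrefix T T.length) u → (i = 0 ∨ ¬ IsNode (revPrefix T i) u) → f (h u) = 0

theorem isNode_of_le {T u : List ℕ} {i j : ℕ} (hij : i ≤ j) (h : IsNode (revPrefix T i) u) :
    IsNode (revPrefix T j) u :=
  h.of_suffix (revPrefix_suffix hij)

theorem IsChild.ne {S u v : List ℕ} {c : ℕ} (h : IsChild S u c v) : u ≠ v := by
  rintro rfl
  have := h.2.2.1.length_le
  simp at this

/-- The table after the insertion of the root and of the leaf. -/
def withLeaf (T : List ℕ) (h : List ℕ → ℕ) (i : ℕ) (f : ℕ → ℕ) : ℕ → ℕ :=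
  Function.update (Function.update f (h []) 1) (h (revPrefix T i)) i

section Table

variable {T : List ℕ} {h : List ℕ → ℕ} {i : ℕ} {f : ℕ → ℕ}

theorem revPrefix_succ_ne_nil (hi : i < T.length) : revPrefix T (i + 1) ≠ [] := by
  rw [revPrefix_succ hi]; simp

theorem withLeaf_leaf : withLeaf T h i f (h (revPrefix T i)) = i := by
  simp [withLeaf]

theorem withLeaf_root (hinj : Set.InjOn h {u | IsNode (revPrefix T T.length) u})
    (hi : i < T.length) : withLeaf T h (i + 1) f (h []) = 1 := by
  have : h [] ≠ h (revPrefix T (i + 1)) := fun e => revPrefix_succ_ne_nil hi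
    (hinj (isNode_nil _) (isNode_revPrefix (by omega)) e).symm
  simp [withLeaf, this]

theorem withLeaf_other (hinj : Set.InjOn h {u | IsNode (revPrefix T T.length) u})
    (hi : i < T.length) {u : List ℕ} (hu : IsNode (revPrefix T T.length) u) (h0 : u ≠ [])
    (h1 : u ≠ revPrefix T (i + 1)) : withLeaf T h (i + 1) f (h u) = f (h u) := by
  have e0 : h u ≠ h [] := fun e => h0 (hinj hu (isNode_nil _) e)
  have e1 : h u ≠ h (revPrefix T (i + 1)) := fun e =>
    h1 (hinj hu (isNode_revPrefix (by omega)) e)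
  simp [withLeaf, e0, e1]

/-- All nodes except the parent of the leaf have correct entries. -/
theorem TableInv.withLeaf_of_ne (hf : TableInv T h i f)
    (hinj : Set.InjOn h {u | IsNode (revPrefix T T.length) u}) (hi : i < T.length)
    {u : List ℕ} {c : ℕ} (hu : IsChild (revPrefix T (i + 1)) u c (revPrefix T (i + 1)))
    {y : List ℕ} (hy : IsNode (revPrefix T (i + 1)) y)
    (hyu : y ≠ u ∨ withLeaf T h (i + 1) f (h u) ≠ 0) :
    FirstOcc T y (withLeaf T h (i + 1) f (h y)) := by
  by_cases h1 : y = revPrefix T (i + 1)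
  · subst h1
    rw [withLeaf_leaf]
    exact firstOcc_revPrefix (by omega) (by omega)
  by_cases h0 : y = []
  · subst h0
    rw [withLeaf_root hinj hi]
    exact firstOcc_nil T
  have hyn : IsNode (revPrefix T T.length) y := isNode_of_le (by omega) hy
  by_cases hold : IsNode (revPrefix T i) y
  · rw [withLeaf_other hinj hi hyn h0 h1]
    refine hf.1 ?_ y hold
    by_contra hi0
    obtain rfl : i = 0 := by omega
    have := hold.infix
    simp [revPrefix] at this
    exact h0 this
  -- A new node other than the leaf is the parent `u`, and its entry is still `0`; this contradicts
  -- both alternatives of `hyu`.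
  · exfalso
    have hyu' : y = u := by
      rw [revPrefix_succ hi] at hu h1 hy
      exact parent_leaf hu hy hold h1
    refine hyu.elim (· hyu') fun hne => hne ?_
    rw [← hyu', withLeaf_other hinj hi hyn h0 h1]
    exact hf.2 y hyn (.inr hold)

/-- Entries of future nodes stay `0`, because pointers are distinct over the whole final tree. This
is what lets a zero entry identify a new node later. -/
theorem TableInv.withLeaf_zero (hf : TableInv T h i f)
    (hinj : Set.InjOn h {u | IsNode (revPrefix T T.length) u}) (hi : i < T.length)
    {y : List ℕ} (hyn : IsNode (revPrefix T T.length) y)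
    (hy : ¬ IsNode (revPrefix T (i + 1)) y) : withLeaf T h (i + 1) f (h y) = 0 := by
  rw [withLeaf_other hinj hi hyn (fun h0 => hy (h0 ▸ isNode_nil _))
    (fun h1 => hy (h1 ▸ isNode_self _))]
  exact hf.2 y hyn (.inr fun h' => hy (isNode_of_le (by omega) h'))

theorem TableInv.succ_of_ne_zero (hf : TableInv T h i f)
    (hinj : Set.InjOn h {u | IsNode (revPrefix T T.length) u}) (hi : i < T.length)
    {u : List ℕ} {c : ℕ} (hu : IsChild (revPrefix T (i + 1)) u c (revPrefix T (i + 1)))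
    (hu0 : withLeaf T h (i + 1) f (h u) ≠ 0) : TableInv T h (i + 1) (withLeaf T h (i + 1) f) :=
  ⟨fun _ _ hy => hf.withLeaf_of_ne hinj hi hu hy (.inr hu0), fun _ hyn hy =>
    hf.withLeaf_zero hinj hi hyn (hy.resolve_left (by omega))⟩

/-- An entry `0` at the parent of the leaf means that it is a new node. -/
theorem TableInv.new_parent (hf : TableInv T h i f)
    (hinj : Set.InjOn h {u | IsNode (revPrefix T T.length) u}) (hi : i < T.length)
    {u : List ℕ} {c : ℕ} (hu : IsChild (revPrefix T (i + 1)) u c (revPrefix T (i + 1)))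
    (hu0 : withLeaf T h (i + 1) f (h u) = 0) :
    1 ≤ i ∧ u ≠ [] ∧ ¬ IsNode (revPrefix T i) u := by
  have hune : u ≠ [] := by
    rintro rfl
    rw [withLeaf_root hinj hi] at hu0
    omega
  have hnew : 1 ≤ i → ¬ IsNode (revPrefix T i) u := fun h1 hold => by
    rw [withLeaf_other hinj hi (isNode_of_le (by omega) hold) hune hu.ne] at hu0
    have := (hf.1 h1 u hold).1
    omega
  -- Over the empty text the parent of the first leaf can only be the root, whose entry has just
  -- been set to `1`.
  have h1 : 1 ≤ i := by
    by_contra hi0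
    obtain rfl : i = 0 := by omega
    have h2 := hu.ne
    rw [revPrefix_succ hi] at hu h2
    have hnil : ∀ y : List ℕ, y <:+: revPrefix T 0 → y = [] := fun y hy => by
      simpa [revPrefix] using hy
    by_cases hold : IsNode (revPrefix T 0) u
    · exact hune (hnil _ hold.infix)
    · exact hune (hnil _ (new_node hu.1 hold h2).1)
  exact ⟨h1, hune, hnew h1⟩

/-- The new parent `u` subdivides the old edge from `x` to `v`. Thus `v` is the old locus of `u`,
both have the same first occurrence, and the entry of `v` can be copied. -/
theorem TableInv.succ_of_zero (hf : TableInv T h i f)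
    (hinj : Set.InjOn h {u | IsNode (revPrefix T T.length) u}) (hi : i < T.length)
    {u x : List ℕ} {c c' : ℕ} (hu : IsChild (revPrefix T (i + 1)) u c (revPrefix T (i + 1)))
    (hu0 : withLeaf T h (i + 1) f (h u) = 0) (hx : IsChild (revPrefix T (i + 1)) x c' u) :
    ∃ v, IsChild (revPrefix T i) x c' v ∧ TableInv T h (i + 1)
      (Function.update (withLeaf T h (i + 1) f) (h u) (withLeaf T h (i + 1) f (h v))) := by
  obtain ⟨h1, hune, hnew⟩ := hf.new_parent hinj hi hu hu0
  have hx' := hx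
  have hune' := hu.ne
  rw [revPrefix_succ hi] at hx' hune'
  obtain ⟨v, hv, hloc⟩ := old_child hnew hune' hx'
  have hun : IsNode (revPrefix T T.length) u := isNode_of_le (by omega) hu.1
  refine ⟨v, hv, fun _ y hy => ?_, fun y hyn hy => ?_⟩
  · by_cases hyu : y = u
    · subst hyu
      rw [Function.update_self]
      have hvn : IsNode (revPrefix T (i + 1)) v := isNode_of_le (by omega) hv.2.1
      have hvy : v ≠ y := fun e => hnew (e ▸ hv.2.1)
      exact hloc.firstOcc h1 (hf.withLeaf_of_ne hinj hi hu hvn (.inl hvy))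
    · have : h y ≠ h u := fun e => hyu (hinj (isNode_of_le (by omega) hy) hun e)
      rw [Function.update_of_ne this]
      exact hf.withLeaf_of_ne hinj hi hu hy (.inl hyu)
  · have hy' := hy.resolve_left (by omega)
    have : h y ≠ h u := fun e => hy' (hinj hyn hun e ▸ hu.1)
    rw [Function.update_of_ne this]
    exact hf.withLeaf_zero hinj hi hyn hy'

end Table

/-- The root is a node even of the empty tree, but nothing has been inserted yet; this is why the
invariant treats `i = 0` apart. -/
theorem tableInv_zero (T : List ℕ) (h : List ℕ → ℕ) : TableInv T h 0 fun _ => 0 :=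
  ⟨fun h => by omega, fun _ _ _ => rfl⟩

/-! ### The current factor -/

/-- `z` factors, start `s` of the last factor `F` and locus `v` of `F` after `i` letters. -/
structure FactorInv (T : List ℕ) (i z s : ℕ) (gs : List (List ℕ)) (F v : List ℕ) : Prop where
  isRevLZ : IsRevLZ (T.take i) (gs ++ [F])
  count : z = gs.length + 1
  start : s = gs.flatten.length + 1
  locus : Locus (revPrefix T i) F v

section Factor

variable {T : List ℕ} {i z s : ℕ} {gs : List (List ℕ)} {F v : List ℕ}

theorem FactorInv.ne_nil (h : FactorInv T i z s gs F v) : F ≠ [] := h.isRevLZ.ne_nil (by simp)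

theorem FactorInv.length (h : FactorInv T i z s gs F v) (hi : i ≤ T.length) :
    F.length + s = i + 1 := by
  have h1 := congrArg List.length h.isRevLZ.1
  have h2 := h.start
  simp only [List.flatten_append, List.flatten_singleton, List.length_append, List.length_take]
    at h1
  omega

theorem FactorInv.flatten (h : FactorInv T i z s gs F v) (hi : i ≤ T.length) :
    gs.flatten = T.take (s - 1) := by
  have h1 := h.isRevLZ.1
  have h3 := h.length hi
  have h4 := List.length_pos_iff.2 h.ne_nil
  rw [List.flatten_append, List.flatten_singleton] at h1
  have h2 := congrArg (List.take gs.flatten.length) h1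
  rw [List.take_left, List.take_take] at h2
  have h5 := h.start
  rw [h2]
  congr 1
  omega

theorem FactorInv.start_pos (h : FactorInv T i z s gs F v) : 1 ≤ s := by
  have := h.start
  omega

/-- The last factor is extended by a letter. -/
theorem FactorInv.extend (h : FactorInv T i z s gs F v) (hi : i < T.length) {v' : List ℕ} {j : ℕ}
    (hv' : Locus (revPrefix T (i + 1)) (F ++ [T[i]]) v') (hj : FirstOcc T v' j) (hjs : j < s) :
    FactorInv T (i + 1) z s gs (F ++ [T[i]]) v' := by
  refine ⟨?_, h.count, h.start, hv'⟩
  rw [List.take_succ_eq_append_getElem hi]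
  refine h.isRevLZ.extend ?_
  rw [h.flatten hi.le, (hv'.firstOcc (by omega) hj).infix_iff (by simp)]
  omega

theorem FactorInv.next (h : FactorInv T i z s gs F v) (hi : i < T.length)
    (hno : ¬ (F ++ [T[i]]).reverse <:+: gs.flatten) {v' : List ℕ}
    (hv' : Locus (revPrefix T (i + 1)) [T[i]] v') :
    FactorInv T (i + 1) (z + 1) (i + 1) (gs ++ [F]) [T[i]] v' := by
  refine ⟨?_, by simp [h.count], ?_, hv'⟩
  · rw [List.take_succ_eq_append_getElem hi]
    refine h.isRevLZ.next fun gs' F' e => ?_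
    obtain ⟨rfl, e2⟩ := List.append_inj' e rfl
    obtain rfl : F = F' := by simpa using e2
    exact hno
  · rw [h.isRevLZ.1]
    simp
    omega

theorem FactorInv.not_infix_of_le (h : FactorInv T i z s gs F v) (hi : i < T.length)
    {v' : List ℕ} {j : ℕ}
    (hv' : Locus (revPrefix T (i + 1)) (F ++ [T[i]]) v') (hj : FirstOcc T v' j) (hjs : ¬ j < s) :
    ¬ (F ++ [T[i]]).reverse <:+: gs.flatten := by
  rw [h.flatten hi.le, (hv'.firstOcc (by omega) hj).infix_iff (by simp)]
  have := h.start_pos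
  omega

theorem FactorInv.not_infix_of_not_infix (h : FactorInv T i z s gs F v) (hi : i < T.length)
    (hno : ¬ F ++ [T[i]] <:+: revPrefix T (i + 1)) :
    ¬ (F ++ [T[i]]).reverse <:+: gs.flatten := by
  intro hF
  rw [h.flatten hi.le, ← List.reverse_infix, List.reverse_reverse] at hF
  have := h.length hi.le
  have h4 := List.length_pos_iff.2 h.ne_nil
  exact hno (hF.trans (revPrefix_suffix (T := T) (i := s - 1) (by omega)).isInfix)

theorem FactorInv.first (hi : 0 < T.length) {v' : List ℕ}
    (hv' : Locus (revPrefix T 1) [T[0]] v') : FactorInv T 1 1 1 [] [T[0]] v' := by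
  refine ⟨?_, rfl, rfl, hv'⟩
  have := isRevLZ_nil.next (c := T[0]) (by simp)
  rw [List.take_succ_eq_append_getElem hi]
  simpa using this

/-- The first inverted copy of `F` ends at `j` and has length `i + 1 - s`, so it starts at `j + s -
i`. -/
theorem FactorInv.reports (h : FactorInv T i z s gs F v) (h1 : 1 ≤ i) (hi : i ≤ T.length) {j : ℕ}
    (hj : FirstOcc T v j) : Reports (T.take i) z s (if j < s then j + s - i else 0) := by
  refine ⟨gs, F, h.isRevLZ, h.count, h.start, ?_⟩
  have hF := h.locus.firstOcc h1 hj
  have hlen := h.length hi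
  have hs := h.start_pos
  have hflat := h.flatten hi
  split_ifs with hjs
  · right
    obtain ⟨t, ht⟩ := hF.2.1
    have ht' := congrArg List.reverse ht
    simp only [revPrefix, List.reverse_append, List.reverse_reverse] at ht'
    have hsplit : gs.flatten = T.take j ++ (T.take (s - 1)).drop j := by
      rw [hflat]
      conv_lhs => rw [← List.take_append_drop j (T.take (s - 1))]
      rw [List.take_take, min_eq_left (by omega)]
    refine ⟨t.reverse, _, by rw [ht']; exact hsplit, ?_⟩
    have h2 := congrArg List.length ht
    have h4 := List.length_pos_iff.2 h.ne_nil
    rw [length_revPrefix (by omega), List.length_append] at h2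
    rw [List.length_reverse]
    omega
  · left
    refine ⟨rfl, ?_⟩
    rw [hflat, hF.infix_iff h.ne_nil]
    omega

end Factor

/-! ### The algorithm

Lanes `0` and `1` hold two copies of the suffix tree data structure, lane `2` the table of first
occurrences, lane `3` the text, and lanes `4` to `7` hold (in their cell `0`) the length of the
text, the start of the last factor, the number of factors and the locus of the last factor.

Variables: `3` the letter, `4` the length of the text, `5` the start of the last factor,
`6` the number of factors, `7` the locus, `8` the new leaf, `9` the root, `10` and `11` further
nodes, `15` zero, `16` one. -/

/-- Load the state and store the letter. -/
def loadState : Cmd :=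
  .seq (.const 16 1) <| .seq (.read 4 4 15) <| .seq (.add 4 4 16) <| .seq (.write 4 15 4) <|
  .seq (.read 5 5 15) <| .seq (.read 6 6 15) <| .seq (.read 7 7 15) <| .write 3 4 3

/-- Update the first copy of the suffix tree and insert the root and the leaf into the table. -/
def insertLeaf (D : SuffixTreeProgram) : Cmd :=
  .seq (.call D.update 1 3 15) <| .seq (.move 8 0) <| .seq (.move 9 1) <|
  .seq (.write 2 9 16) <| .write 2 8 4

/-- Insert the parent of the leaf into the table if it is new; its entry is found with the second
copy, which is the suffix tree before the update. -/
def insertParent (D : SuffixTreeProgram) : Cmd :=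
  .seq (.call D.node 1 8 15) <| .seq (.move 10 0) <| .seq (.read 2 12 10) <|
  .ite 12 .skip <|
    .seq (.call D.node 1 10 15) <| .seq (.move 11 0) <| .seq (.call D.node 1 11 15) <|
    -- The leaf is the text read leftwards from its last position, so the letter following its
    -- prefix `x` stands `|x|` positions to the left.
    .seq (.sub 12 4 1) <| .seq (.read 3 12 12) <| .seq (.call D.child 0 11 12) <|
    .seq (.read 2 12 1) <| .write 2 10 12

/-- Move the locus of the last factor to the updated suffix tree. -/
def adjustLocus (D : SuffixTreeProgram) : Cmd :=
  .seq (.sub 13 4 5) <| .seq (.call D.node 1 7 15) <| .seq (.move 10 0) <|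
  .seq (.call D.node 1 10 15) <| .seq (.lt 12 1 13) <| .ite 12 .skip (.move 7 10)

/-- Try to extend the last factor by the letter; the flag `17` reports success. -/
def extendFactor (D : SuffixTreeProgram) : Cmd :=
  .seq (.call D.node 1 7 15) <| .seq (.eq 12 1 13) <|
  .seq (.ite 12 (.seq (.call D.child 1 7 3) <| .seq (.move 17 0) (.move 7 1))
    (.seq (.sub 12 2 13) <| .seq (.read 3 12 12) (.eq 17 12 3))) <|
  .ite 17 (.seq (.read 2 12 7) (.lt 17 12 5)) .skip

/-- Start a new factor with the letter. -/
def newFactor (D : SuffixTreeProgram) : Cmd :=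
  .seq (.add 6 6 16) <| .seq (.move 5 4) <| .seq (.call D.child 1 9 3) (.move 7 1)

/-- Store the state and compute the position of the inverted copy in variable `14`. -/
def storeState : Cmd :=
  .seq (.read 2 12 7) <| .seq (.lt 13 12 5) <| .seq (.const 14 0) <|
  .seq (.ite 13 (.seq (.add 14 12 5) (.sub 14 14 4)) .skip) <|
  .seq (.write 5 15 5) <| .seq (.write 6 15 6) (.write 7 15 7)

/-- Processing a letter. -/
def letterStep (D : SuffixTreeProgram) : Cmd :=
  .seq loadState <| .seq (insertLeaf D) <| .seq (insertParent D) <|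
  -- The lagging copy catches up only now, after its last query about the old tree.
  .seq (.call D.update 0 3 15) <|
  .seq (.seq (.const 17 0) <| .ite 6 (.seq (adjustLocus D) (extendFactor D)) .skip) <|
  .seq (.ite 17 .skip (newFactor D)) storeState

/-! ### Calls to the data structure -/

/-- The memory `M` supports the queries to the suffix tree of the inverted prefix of length `i`. -/
structure TreeState (D : SuffixTreeProgram) (w σ N d : ℕ) (T : List ℕ) (h : List ℕ → ℕ) (i : ℕ)
    (M : ℕ → ℕ) : Prop where
  lt : ∀ u, IsNode (revPrefix T i) u → h u < d
  node : ∀ v, IsNode (revPrefix T i) v → ∃ out, Call w D.node [h v, 0] M M out N d ∧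
    (∀ u c, IsChild (revPrefix T i) u c v → out 0 = h u) ∧ out 1 = v.length ∧ out 2 ≤ i ∧
    v <+: revPrefix T (out 2)
  child : ∀ u, IsNode (revPrefix T i) u → ∀ c < σ, ∃ out, Call w D.child [h u, c] M M out N d ∧
    (∀ v, IsChild (revPrefix T i) u c v → out 0 = 1 ∧ out 1 = h v) ∧
    ((¬ ∃ v, IsChild (revPrefix T i) u c v) → out 0 = 0)

theorem Call.mono {w : ℕ} {p : Prog} {args : List ℕ} {M M' out : ℕ → ℕ} {B B' : ℝ} {m m' : ℕ}
    (h : Call w p args M M' out B m) (hB : B ≤ B') (hm : m ≤ m') :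
    Call w p args M M' out B' m' := by
  obtain ⟨τ, m₀, he, h1, h2⟩ := h
  exact ⟨τ, m₀, he, h1.trans hB, h2.trans hm⟩

/-- Step counts are integers, so the real time bound can be replaced by a natural number. -/
theorem Call.floor {w : ℕ} {p : Prog} {args : List ℕ} {M M' out : ℕ → ℕ} {B : ℝ} {m : ℕ}
    (h : Call w p args M M' out B m) : Call w p args M M' out (⌊B⌋₊ : ℕ) m := by
  obtain ⟨τ, m₀, he, h1, h2⟩ := h
  exact ⟨τ, m₀, he, by exact_mod_cast Nat.le_floor h1, h2⟩

/-- Commands always pass two arguments; a second argument `0` equals the default content of the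
register. -/
theorem Call.append_zero {w : ℕ} {p : Prog} {a : ℕ} {M M' out : ℕ → ℕ} {B : ℝ} {m : ℕ}
    (h : Call w p [a] M M' out B m) : Call w p [a, 0] M M' out B m := by
  have : (fun i => [a, 0].getD i 0) = fun i => [a].getD i 0 := by
    funext i
    rcases i with _ | _ | i <;> simp
  unfold Call
  rwa [this]

theorem TreeState.mono {D : SuffixTreeProgram} {w σ N d d' : ℕ} {T : List ℕ} {h : List ℕ → ℕ}
    {i : ℕ} {M : ℕ → ℕ} (hT : TreeState D w σ N d T h i M) (hd : d ≤ d') :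
    TreeState D w σ N d' T h i M := by
  refine ⟨fun u hu => (hT.lt u hu).trans_le hd, fun v hv => ?_, fun u hu c hc => ?_⟩
  · obtain ⟨out, h1, h2⟩ := hT.node v hv
    exact ⟨out, h1.mono le_rfl hd, h2⟩
  · obtain ⟨out, h1, h2⟩ := hT.child u hu c hc
    exact ⟨out, h1.mono le_rfl hd, h2⟩

theorem SuffixTreeProgram.Maintains.treeState {D : SuffixTreeProgram} {C w σ : ℕ} {B : ℝ}
    {T : List ℕ} (hD : D.Maintains C w σ B T) :
    ∃ (M : ℕ → ℕ → ℕ) (h : List ℕ → ℕ), M 0 = (fun _ => 0) ∧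
      Set.InjOn h {u | IsNode (revPrefix T T.length) u} ∧
      ∀ (i : ℕ) (hi : i < T.length),
        TreeState D w σ ⌊B⌋₊ (C * (i + 1)) T h (i + 1) (M (i + 1)) ∧
        ∃ out, Call w D.update [T[i], 0] (M i) (M (i + 1)) out (⌊B⌋₊ : ℕ) (C * (i + 1)) ∧
          out 0 = h (revPrefix T (i + 1)) ∧ out 1 = h [] := by
  obtain ⟨M, h, hM, hstep⟩ := hD
  refine ⟨M, h, funext hM, ?_, fun i hi => ?_⟩
  -- For the empty text the hypothesis on `D` says nothing about `h`, but then the empty string is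
  -- the only node.
  · rcases Nat.eq_zero_or_pos T.length with h0 | hpos
    · intro u hu v hv _
      have e : revPrefix T T.length = [] := by simp [h0, revPrefix]
      rw [e] at hu hv
      rw [List.infix_nil.1 (IsNode.infix hu), List.infix_nil.1 (IsNode.infix hv)]
    · have := (hstep (T.length - 1) (by omega)).1
      rwa [Nat.sub_add_cancel hpos] at this
  · obtain ⟨-, h2, ⟨out, h3, h3'⟩, h4, h5⟩ := hstep i hi
    refine ⟨⟨h2, fun v hv => ?_, fun u hu c hc => ?_⟩, out, h3.floor.append_zero, h3'⟩
    · obtain ⟨out, h6, h7⟩ := h4 v hv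
      exact ⟨out, h6.floor.append_zero, h7⟩
    · obtain ⟨out, h6, h7⟩ := h5 u hu c hc
      exact ⟨out, h6.floor, h7⟩

/-! ### Weakest preconditions of the basic commands and of the updates of tree and table -/

section WP

variable {w N d m : ℕ} {g : ℕ → ℕ} {L : ℕ → ℕ → ℕ} {Q : (ℕ → ℕ) → (ℕ → ℕ → ℕ) → Prop}

theorem wp_seq {p q : Cmd} : (Cmd.seq p q).wp w N d m g L Q ↔
    p.wp w N d m g L fun g' L' => q.wp w N d m g' L' Q := Iff.rfl

theorem wp_const {k c : ℕ} :
    (Cmd.const k c).wp w N d m g L Q ↔ Q (Function.update g k c) L := Iff.rfl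

theorem wp_move {k a : ℕ} :
    (Cmd.move k a).wp w N d m g L Q ↔ Q (Function.update g k (g a)) L := Iff.rfl

theorem wp_add {k a b : ℕ} : (Cmd.add k a b).wp w N d m g L Q ↔
    g a + g b < 2 ^ w ∧ Q (Function.update g k (g a + g b)) L := Iff.rfl

theorem wp_sub {k a b : ℕ} : (Cmd.sub k a b).wp w N d m g L Q ↔
    g b ≤ g a ∧ g a < 2 ^ w ∧ Q (Function.update g k (g a - g b)) L := Iff.rfl

theorem wp_lt {k a b : ℕ} : (Cmd.lt k a b).wp w N d m g L Q ↔
    Q (Function.update g k (if g a < g b then 1 else 0)) L := Iff.rfl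

theorem wp_eq {k a b : ℕ} : (Cmd.eq k a b).wp w N d m g L Q ↔
    Q (Function.update g k (if g a = g b then 1 else 0)) L := Iff.rfl

theorem wp_read {o k a : ℕ} : (Cmd.read o k a).wp w N d m g L Q ↔
    g a < m ∧ Q (Function.update g k (L o (g a))) L := Iff.rfl

theorem wp_write {o a b : ℕ} : (Cmd.write o a b).wp w N d m g L Q ↔
    g a < m ∧ Q g (Function.update L o (Function.update (L o) (g a) (g b))) := Iff.rfl

theorem wp_ite {k : ℕ} {p q : Cmd} : (Cmd.ite k p q).wp w N d m g L Q ↔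
    (g k ≠ 0 → p.wp w N d m g L Q) ∧ (g k = 0 → q.wp w N d m g L Q) := Iff.rfl

theorem wp_skip : Cmd.skip.wp w N d m g L Q ↔ Q g L := Iff.rfl

/-- The variables after a call. -/
def withResults (g out : ℕ → ℕ) : ℕ → ℕ :=
  Function.update (Function.update (Function.update g 0 (out 0)) 1 (out 1)) 2 (out 2)

@[simp] theorem withResults_zero {g out : ℕ → ℕ} : withResults g out 0 = out 0 := by
  simp [withResults]

@[simp] theorem withResults_one {g out : ℕ → ℕ} : withResults g out 1 = out 1 := by
  simp [withResults]

@[simp] theorem withResults_two {g out : ℕ → ℕ} : withResults g out 2 = out 2 := by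
  simp [withResults]

theorem withResults_of_le {g out : ℕ → ℕ} {k : ℕ} (hk : 3 ≤ k) : withResults g out k = g k := by
  have h0 : k ≠ 0 := by omega
  have h1 : k ≠ 1 := by omega
  have h2 : k ≠ 2 := by omega
  simp [withResults, h0, h1, h2]

variable {D : SuffixTreeProgram} {σ : ℕ} {T : List ℕ} {h : List ℕ → ℕ} {i : ℕ} {M : ℕ → ℕ}

theorem wp_update {o a b x : ℕ} {M' out : ℕ → ℕ} (hc : Call w D.update [x, 0] M M' out N d)
    (hM : L o = M) (ha : g a = x) (hb : g b = 0)
    (hQ : Q (withResults g out) (Function.update L o M')) :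
    (Cmd.call D.update o a b).wp w N d m g L Q :=
  ⟨M', out, by rwa [hM, ha, hb], hQ⟩

theorem wp_node (hT : TreeState D w σ N d T h i M) {o a b : ℕ} (hM : L o = M) {v : List ℕ}
    (hv : IsNode (revPrefix T i) v) (ha : g a = h v) (hb : g b = 0)
    (hQ : ∀ out : ℕ → ℕ, (∀ u c, IsChild (revPrefix T i) u c v → out 0 = h u) →
      out 1 = v.length → out 2 ≤ i → v <+: revPrefix T (out 2) → Q (withResults g out) L) :
    (Cmd.call D.node o a b).wp w N d m g L Q := by
  obtain ⟨out, h1, h2, h3, h4, h5⟩ := hT.node v hv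
  refine ⟨M, out, by rwa [hM, ha, hb], ?_⟩
  rw [← hM, Function.update_eq_self]
  exact hQ out h2 h3 h4 h5

theorem wp_child (hT : TreeState D w σ N d T h i M) {o a b c : ℕ} (hM : L o = M) {u : List ℕ}
    (hu : IsNode (revPrefix T i) u) (ha : g a = h u) (hb : g b = c) (hc : c < σ)
    (hQ : ∀ out : ℕ → ℕ, (∀ v, IsChild (revPrefix T i) u c v → out 0 = 1 ∧ out 1 = h v) →
      ((¬ ∃ v, IsChild (revPrefix T i) u c v) → out 0 = 0) → Q (withResults g out) L) :
    (Cmd.call D.child o a b).wp w N d m g L Q := by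
  obtain ⟨out, h1, h2, h3⟩ := hT.child u hu c hc
  refine ⟨M, out, by rwa [hM, ha, hb], ?_⟩
  rw [← hM, Function.update_eq_self]
  exact hQ out h2 h3

/-- The contents of the main variables. -/
structure Vars (g : ℕ → ℕ) (c i s z v : ℕ) : Prop where
  letter : g 3 = c
  length : g 4 = i
  start : g 5 = s
  count : g 6 = z
  locus : g 7 = v
  zero : g 15 = 0
  one : g 16 = 1

theorem Vars.congr {g g' : ℕ → ℕ} {c i s z v : ℕ} (hg : Vars g c i s z v)
    (h3 : g' 3 = g 3) (h4 : g' 4 = g 4) (h5 : g' 5 = g 5) (h6 : g' 6 = g 6) (h7 : g' 7 = g 7)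
    (h15 : g' 15 = g 15) (h16 : g' 16 = g 16) : Vars g' c i s z v :=
  ⟨h3.trans hg.1, h4.trans hg.2, h5.trans hg.3, h6.trans hg.4, h7.trans hg.5, h15.trans hg.6,
    h16.trans hg.7⟩

theorem wp_loadState {c : ℕ} (hc : g 3 = c) (h0 : g 15 = 0) (hi : L 4 0 = i) (him : i + 1 < m)
    (hw : m ≤ 2 ^ w)
    (hQ : ∀ g' L', Vars g' c (i + 1) (L 5 0) (L 6 0) (L 7 0) → L' 0 = L 0 → L' 1 = L 1 →
      L' 2 = L 2 → L' 3 = Function.update (L 3) (i + 1) c → L' 4 0 = i + 1 → Q g' L') :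
    loadState.wp w N d m g L Q := by
  simp only [loadState, wp_seq, wp_const, wp_read, wp_add, wp_write]
  refine ⟨?_, ?_, ?_, ?_, ?_, ?_, ?_, hQ _ _ ⟨?_, ?_, ?_, ?_, ?_, ?_, ?_⟩ ?_ ?_ ?_ ?_ ?_⟩ <;>
  simp [hc, h0, hi] <;> omega

theorem wp_insertLeaf {c s z v : ℕ} {M' out : ℕ → ℕ} (hg : Vars g c (i + 1) s z v)
    (hc : Call w D.update [c, 0] M M' out N d) (hM : L 1 = M)
    (h0 : out 0 = h (revPrefix T (i + 1))) (h1 : out 1 = h [])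
    (hm : ∀ u, IsNode (revPrefix T (i + 1)) u → h u < m)
    (hQ : ∀ g' L', Vars g' c (i + 1) s z v → g' 8 = h (revPrefix T (i + 1)) → g' 9 = h [] →
      L' 0 = L 0 → L' 1 = M' → L' 2 = withLeaf T h (i + 1) (L 2) → L' 3 = L 3 → L' 4 = L 4 →
      Q g' L') : (insertLeaf D).wp w N d m g L Q := by
  simp only [insertLeaf, wp_seq, wp_move, wp_write]
  refine wp_update hc hM hg.letter hg.zero ?_
  have e : ∀ k, 3 ≤ k → withResults g out k = g k := fun k => withResults_of_le
  refine ⟨?_, ?_, hQ _ _ (hg.congr ?_ ?_ ?_ ?_ ?_ ?_ ?_) ?_ ?_ ?_ ?_ ?_ ?_ ?_⟩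
  · simpa [Function.update_apply, h1] using hm _ (isNode_nil _)
  · simpa [Function.update_apply, h0] using hm _ (isNode_self _)
  all_goals simp [withLeaf, h0, h1, e, hg.length, hg.one]

theorem wp_insertParent {c s z v : ℕ} {M' f : ℕ → ℕ} (hg : Vars g c (i + 1) s z v)
    (hi : i < T.length) (hinj : Set.InjOn h {u | IsNode (revPrefix T T.length) u})
    (hσ : ∀ a ∈ T, a < σ) (hw : m ≤ 2 ^ w) (him : i + 1 < m) (hdm : d ≤ m)
    (hM : L 0 = M) (hM' : L 1 = M') (hT : 1 ≤ i → TreeState D w σ N d T h i M)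
    (hT' : TreeState D w σ N d T h (i + 1) M') (hf : TableInv T h i f)
    (hL : L 2 = withLeaf T h (i + 1) f) (hL3 : ∀ k (_ : k < T.length), k ≤ i → L 3 (k + 1) = T[k])
    (h8 : g 8 = h (revPrefix T (i + 1)))
    (hQ : ∀ g' L', Vars g' c (i + 1) s z v → g' 9 = g 9 →
      L' 0 = M → L' 1 = M' → TableInv T h (i + 1) (L' 2) → L' 3 = L 3 → L' 4 = L 4 →
      Q g' L') : (insertParent D).wp w N d m g L Q := by
  simp only [insertParent, wp_seq, wp_move, wp_read, wp_write, wp_ite, wp_skip, wp_sub]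
  refine wp_node hT' hM' (isNode_self _) h8 hg.zero fun out h1 _ _ _ => ?_
  obtain ⟨u, a, -, hu⟩ := exists_parent (isNode_self (revPrefix T (i + 1)))
    (revPrefix_succ_ne_nil hi)
  have hu0 := h1 u a hu
  have e : ∀ g out k, 3 ≤ k → withResults g out k = g k := fun g out k => withResults_of_le
  simp only [withResults_zero, Function.update_self, hL, hu0]
  refine ⟨(hT'.lt u hu.1).trans_le hdm, fun hne => ?_, fun hz => ?_⟩
  · refine hQ _ _ (hg.congr ?_ ?_ ?_ ?_ ?_ ?_ ?_) ?_ hM hM' ?_ rfl rfl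
    all_goals try simp [e]
    rw [hL]
    exact hf.succ_of_ne_zero hinj hi hu hne
  -- A new parent forces `1 ≤ i`, so the lagging copy already holds a tree that can be queried.
  · obtain ⟨hi1, hune, -⟩ := hf.new_parent hinj hi hu hz
    obtain ⟨x, b, hxu, hx⟩ := exists_parent hu.1 hune
    refine wp_node hT' hM' hu.1 (by simp )
      (by simp [e, hg.zero]) fun out' h1' _ _ _ => ?_
    refine wp_node hT' hM' hx.1 (by simp [h1' x b hx])
      (by simp [e, hg.zero]) fun out'' _ h2'' _ _ => ?_
    have hup : u <+: revPrefix T (i + 1) := (List.prefix_append u [a]).trans hu.2.2.1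
    obtain ⟨hk, hk', hb⟩ := getElem_of_prefix_revPrefix (hxu.trans hup) (by omega)
      (k := x.length) (by simp)
    simp only [List.getElem_concat_length] at hb
    refine ⟨?_, ?_, ?_, ?_⟩
    · simp [e, hg.length, h2'']; omega
    · simp [e, hg.length]; omega
    · simp [e, hg.length, h2'']; omega
    have hL3' := hL3 (i + 1 - x.length - 1) hk (by omega)
    rw [Nat.sub_add_cancel (by omega), ← hb] at hL3'
    obtain ⟨y, hy, htab⟩ := hf.succ_of_zero hinj hi hu hz hx
    refine wp_child (hT hi1) hM hy.1
      (by simp [e, h1' x b hx])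
      (by simpa [Function.update_apply, e, hg.length, h2''] using hL3')
      (hσ b (hb ▸ List.getElem_mem hk)) fun out3 h3 _ => ?_
    have hy1 := (h3 y hy).2
    refine ⟨?_, ?_, ?_⟩
    · simpa [hy1] using ((hT hi1).lt y hy.2.1).trans_le hdm
    · simpa [Function.update_apply, e] using (hT'.lt u hu.1).trans_le hdm
    refine hQ _ _ (hg.congr ?_ ?_ ?_ ?_ ?_ ?_ ?_) ?_ ?_ ?_ ?_ ?_ ?_
    all_goals try simp [e]
    · exact hM
    · exact hM'
    · rw [hL, hy1]
      convert htab using 1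

end WP

/-! ### Correctness of the commands that maintain the last factor -/

section WP

variable {w N d m : ℕ} {g : ℕ → ℕ} {L : ℕ → ℕ → ℕ} {Q : (ℕ → ℕ) → (ℕ → ℕ → ℕ) → Prop}

variable {D : SuffixTreeProgram} {σ : ℕ} {T : List ℕ} {h : List ℕ → ℕ} {i : ℕ} {M : ℕ → ℕ}

theorem wp_adjustLocus {c s z : ℕ} {gs : List (List ℕ)} {F v : List ℕ}
    (hg : Vars g c (i + 1) s z (h v)) (hi : i < T.length) (hw : m ≤ 2 ^ w) (him : i + 1 < m)
    (hM : L 1 = M) (hT : TreeState D w σ N d T h (i + 1) M) (hF : FactorInv T i z s gs F v)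
    (hQ : ∀ g' v', Vars g' c (i + 1) s z (h v') → g' 9 = g 9 → g' 13 = F.length → g' 17 = g 17 →
      Locus (revPrefix T (i + 1)) F v' → Q g' L) : (adjustLocus D).wp w N d m g L Q := by
  have hlen := hF.length hi.le
  have e : ∀ g out k, 3 ≤ k → withResults g out k = g k := fun g out k => withResults_of_le
  have hvn : IsNode (revPrefix T (i + 1)) v := isNode_of_le (by omega) hF.locus.1
  have hv0 : v ≠ [] := fun h0 => hF.ne_nil (List.prefix_nil.1 (h0 ▸ hF.locus.2.1))
  obtain ⟨y, b, -, hy⟩ := exists_parent hvn hv0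
  simp only [adjustLocus, wp_seq, wp_move, wp_ite, wp_skip, wp_sub, wp_lt]
  refine ⟨by rw [hg.start, hg.length]; omega, by rw [hg.length]; omega, ?_⟩
  refine wp_node hT hM hvn (by simpa using hg.locus) (by simpa using hg.zero)
    fun out h1 _ _ _ => ?_
  refine wp_node hT hM hy.1 (by simpa using h1 y b hy) (by simp [e, hg.zero])
    fun out' _ h2 _ _ => ?_
  have hlocus : (F.length ≤ y.length → Locus (revPrefix T (i + 1)) F y) ∧
      (y.length < F.length → Locus (revPrefix T (i + 1)) F v) := by
    rw [revPrefix_succ hi] at hy ⊢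
    exact hF.locus.cons hy
  have h13 : g 4 - g 5 = F.length := by rw [hg.start, hg.length]; omega
  have hV : ∀ g', g' 3 = g 3 → g' 4 = g 4 → g' 5 = g 5 → g' 6 = g 6 → g' 15 = g 15 → g' 16 = g 16 →
      ∀ x, g' 7 = x → Vars g' c (i + 1) s z x := fun g' h3 h4 h5 h6 h15 h16 x h7 =>
    ⟨h3.trans hg.1, h4.trans hg.2, h5.trans hg.3, h6.trans hg.4, h7, h15.trans hg.6,
      h16.trans hg.7⟩
  constructor
  · intro hne
    have hlt : y.length < F.length := by
      by_contra hge
      simp [e, h2, h13, hge] at hne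
    refine hQ _ v (hV _ ?_ ?_ ?_ ?_ ?_ ?_ _ ?_) ?_ ?_ ?_ (hlocus.2 hlt)
    all_goals simp [e, h13, hg.locus]
  · intro hz
    have hge : F.length ≤ y.length := by
      by_contra hlt
      simp [e, h2, h13] at hz
      omega
    refine hQ _ y (hV _ ?_ ?_ ?_ ?_ ?_ ?_ _ ?_) ?_ ?_ ?_ (hlocus.1 hge)
    all_goals simp [e, h13, h1 y b hy]

theorem wp_extendFactor {s z : ℕ} {gs : List (List ℕ)} {F v v₀ : List ℕ} (hi : i < T.length)
    (hg : Vars g T[i] (i + 1) s z (h v)) (hw : m ≤ 2 ^ w) (him : i + 1 < m) (hdm : d ≤ m)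
    (hσ : ∀ a ∈ T, a < σ)
    (hM : L 1 = M) (hT : TreeState D w σ N d T h (i + 1) M) (hf : TableInv T h (i + 1) (L 2))
    (hL3 : ∀ k (_ : k < T.length), k ≤ i → L 3 (k + 1) = T[k])
    (h13 : g 13 = F.length) (hF : FactorInv T i z s gs F v₀)
    (hv : Locus (revPrefix T (i + 1)) F v)
    (hQ : ∀ g' x, Vars g' T[i] (i + 1) s z x → g' 9 = g 9 →
      (g' 17 ≠ 0 → ∃ v', x = h v' ∧ FactorInv T (i + 1) z s gs (F ++ [T[i]]) v') →
      (g' 17 = 0 → ¬ (F ++ [T[i]]).reverse <:+: gs.flatten) → Q g' L) :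
    (extendFactor D).wp w N d m g L Q := by
  have e : ∀ g out k, 3 ≤ k → withResults g out k = g k := fun g out k => withResults_of_le
  have hV : ∀ g', g' 3 = g 3 → g' 4 = g 4 → g' 5 = g 5 → g' 6 = g 6 → g' 15 = g 15 → g' 16 = g 16 →
      ∀ x, g' 7 = x → Vars g' T[i] (i + 1) s z x := fun g' h3 h4 h5 h6 h15 h16 x h7 =>
    ⟨h3.trans hg.1, h4.trans hg.2, h5.trans hg.3, h6.trans hg.4, h7, h15.trans hg.6,
      h16.trans hg.7⟩
  -- Whether `F` ends at a node or inside an edge, it remains to compare the first occurrence of the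
  -- extended factor with `s`. This is settled once for both cases.
  have test : ∀ g', g' 3 = g 3 → g' 4 = g 4 → g' 5 = g 5 → g' 6 = g 6 → g' 15 = g 15 →
      g' 16 = g 16 → g' 9 = g 9 →
      (g' 17 ≠ 0 → ∃ v', g' 7 = h v' ∧ Locus (revPrefix T (i + 1)) (F ++ [T[i]]) v') →
      (g' 17 = 0 → ¬ F ++ [T[i]] <:+: revPrefix T (i + 1)) →
      (Cmd.ite 17 (.seq (.read 2 12 7) (.lt 17 12 5)) .skip).wp w N d m g' L Q := by
    intro g' h3 h4 h5 h6 h15 h16 h9 hyes hno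
    simp only [wp_ite, wp_seq, wp_read, wp_lt, wp_skip]
    constructor
    · intro hne
      obtain ⟨v', hv', hloc⟩ := hyes hne
      have hj := hf.1 (by omega) v' hloc.1
      refine ⟨by rw [hv']; exact (hT.lt v' hloc.1).trans_le hdm,
        hQ _ _ (hV _ ?_ ?_ ?_ ?_ ?_ ?_ _ rfl) ?_ ?_ ?_⟩
      all_goals try simp [h3, h4, h5, h6, h15, h16, h9]
      · intro hlt
        rw [hv', hg.start] at hlt
        exact ⟨v', hv', hF.extend hi hloc hj hlt⟩
      · intro hge
        rw [hv', hg.start] at hge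
        simpa using hF.not_infix_of_le hi hloc hj (by omega)
    · intro hz
      exact hQ _ _ (hV _ h3 h4 h5 h6 h15 h16 _ rfl) h9 (fun hne => absurd hz hne)
        fun _ => hF.not_infix_of_not_infix hi (hno hz)
  unfold extendFactor
  rw [wp_seq]
  refine wp_node hT hM hv.1 hg.locus hg.zero fun out _ h2 h3 h4 => ?_
  rw [wp_seq, wp_eq, wp_seq, wp_ite]
  constructor
  · intro hne
    have hlen : v.length = F.length := by
      by_contra hlen
      simp [e, h2, h13, hlen] at hne
    obtain rfl : F = v := hv.2.1.eq_of_length hlen.symm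
    rw [wp_seq]
    refine wp_child hT hM hv.1 (by simp [e, hg.locus]) (c := T[i]) (by simp [e, hg.letter])
      (hσ _ (List.getElem_mem hi)) fun out' h5 h6 => ?_
    simp only [wp_seq, wp_move]
    have hex : F ++ [T[i]] <:+: revPrefix T (i + 1) →
        ∃ v', IsChild (revPrefix T (i + 1)) F T[i] v' := fun hin =>
      (exists_locus hin).imp fun v' hv' => ⟨hv.1, hv'⟩
    refine test _ ?_ ?_ ?_ ?_ ?_ ?_ ?_ ?_ ?_
    all_goals try simp [e]
    · intro hne'
      by_contra! hcon
      refine hne' (h6 ?_)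
      rintro ⟨v', hv'⟩
      exact hcon v' (h5 v' hv').2 hv'.2
    · intro hz hin
      obtain ⟨v', hv'⟩ := hex hin
      have := (h5 v' hv').1
      omega
  -- Here `F` ends strictly inside the edge to `v`. The only possible next letter is read from the
  -- text, `|F|` positions to the left of the position reported for `v`.
  · intro hz
    have hlen : F.length < v.length := by
      refine lt_of_le_of_ne hv.2.1.length_le fun hlen => ?_
      simp [e, h2, h13, hlen] at hz
    have hne : F ≠ v := by
      rintro rfl
      exact hlen.ne rfl
    obtain ⟨b, hb⟩ := exists_append_singleton_prefix hv.2.1 hne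
    obtain ⟨hk, hk', hbk⟩ := getElem_of_prefix_revPrefix (hb.trans h4) (by omega)
      (k := F.length) (by simp)
    simp only [List.getElem_concat_length] at hbk
    have hL3' := hL3 (out 2 - F.length - 1) hk (by omega)
    rw [Nat.sub_add_cancel (by omega), ← hbk] at hL3'
    simp only [wp_seq, wp_sub, wp_read, wp_eq]
    refine ⟨?_, ?_, ?_, test _ ?_ ?_ ?_ ?_ ?_ ?_ ?_ ?_ ?_⟩
    all_goals try simp [e, h13]
    · omega
    · omega
    · omega
    · intro hbc
      rw [hL3', hg.letter] at hbc
      exact ⟨v, hg.locus, hv.append (hbc ▸ hb)⟩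
    · intro hbc hin
      rw [hL3', hg.letter] at hbc
      exact hbc (append_singleton_inj hb (hv.prefix_of_infix hne hin))

/-- The state of the factorization is correct after `i` letters, where `x` is the pointer to the
locus. -/
def StateInv (T : List ℕ) (h : List ℕ → ℕ) (i z s x : ℕ) : Prop :=
  (i = 0 ∧ z = 0) ∨ ∃ gs F v, 1 ≤ i ∧ FactorInv T i z s gs F v ∧ x = h v

theorem wp_newFactor {s z x : ℕ} (hi : i < T.length)
    (hg : Vars g T[i] (i + 1) s z x) (hw : m ≤ 2 ^ w) (him : i + 1 < m) (hz : z ≤ i)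
    (hσ : ∀ a ∈ T, a < σ) (hM : L 1 = M) (hT : TreeState D w σ N d T h (i + 1) M)
    (h9 : g 9 = h [])
    (hnew : (i = 0 ∧ z = 0) ∨ ∃ gs F v, FactorInv T i z s gs F v ∧
      ¬ (F ++ [T[i]]).reverse <:+: gs.flatten)
    (hQ : ∀ g' s' z' gs F v, Vars g' T[i] (i + 1) s' z' (h v) →
      FactorInv T (i + 1) z' s' gs F v → Q g' L) :
    (newFactor D).wp w N d m g L Q := by
  have e : ∀ g out k, 3 ≤ k → withResults g out k = g k := fun g out k => withResults_of_le
  simp only [newFactor, wp_seq, wp_add, wp_move]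
  refine ⟨by rw [hg.count, hg.one]; omega, ?_⟩
  refine wp_child hT hM (isNode_nil _) (by simpa using h9) (c := T[i])
    (by simpa using hg.letter) (hσ _ (List.getElem_mem hi)) fun out h1 _ => ?_
  -- The updated tree contains the new letter, so the child of the root exists even if the letter is
  -- new.
  have hin : [T[i]] <:+: revPrefix T (i + 1) := by
    rw [revPrefix_succ hi]
    exact (List.prefix_append [T[i]] (revPrefix T i)).isInfix
  obtain ⟨v, hv⟩ := exists_locus hin
  have h7 := (h1 v ⟨isNode_nil _, hv⟩).2
  have hV : Vars (Function.update (withResults (Function.update (Function.update g 6 (g 6 + g 16))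
      5 (Function.update g 6 (g 6 + g 16) 4)) out) 7
      (withResults (Function.update (Function.update g 6 (g 6 + g 16))
      5 (Function.update g 6 (g 6 + g 16) 4)) out 1)) T[i] (i + 1) (i + 1) (z + 1) (h v) := by
    constructor <;> simp [e, hg.letter, hg.length, hg.count, hg.one, hg.zero, h7]
  rcases hnew with ⟨rfl, rfl⟩ | ⟨gs, F, v₀, hF, hno⟩
  · exact hQ _ _ _ _ _ v hV (FactorInv.first hi hv)
  · exact hQ _ _ _ _ _ v hV (hF.next hi hno hv)

/-- Factors are nonempty, so there are at most `i` of them; this keeps the counter from overflowing.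
-/
theorem FactorInv.count_le {z s : ℕ} {gs : List (List ℕ)} {F v : List ℕ}
    (hF : FactorInv T i z s gs F v) : z ≤ i := by
  have h1 : (gs ++ [F]).length ≤ (gs ++ [F]).flatten.length := by
    rw [List.length_flatten]
    refine (List.length_le_sum_of_one_le _ ?_).trans' (by simp)
    simp only [List.mem_map]
    rintro _ ⟨G, hG, rfl⟩
    exact List.length_pos_iff.2 (hF.isRevLZ.ne_nil hG)
  rw [hF.isRevLZ.1] at h1
  simp at h1
  have := hF.count
  omega

theorem wp_factor {s z x : ℕ} (hi : i < T.length)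
    (hg : Vars g T[i] (i + 1) s z x) (hw : m ≤ 2 ^ w) (him : i + 1 < m) (hdm : d ≤ m)
    (hσ : ∀ a ∈ T, a < σ) (hM : L 1 = M) (hT : TreeState D w σ N d T h (i + 1) M)
    (hf : TableInv T h (i + 1) (L 2))
    (hL3 : ∀ k (_ : k < T.length), k ≤ i → L 3 (k + 1) = T[k])
    (h9 : g 9 = h []) (hs : StateInv T h i z s x)
    (hQ : ∀ g' s' z' gs F v, Vars g' T[i] (i + 1) s' z' (h v) →
      FactorInv T (i + 1) z' s' gs F v → Q g' L) :
    (Cmd.seq (.seq (.const 17 0) <| .ite 6 (.seq (adjustLocus D) (extendFactor D)) .skip)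
      (.ite 17 .skip (newFactor D))).wp w N d m g L Q := by
  rw [wp_seq, wp_seq, wp_const, wp_ite]
  have hg' : Vars (Function.update g 17 0) T[i] (i + 1) s z x :=
    hg.congr (by simp) (by simp) (by simp) (by simp) (by simp) (by simp) (by simp)
  have h9' : Function.update g 17 0 9 = h [] := by simpa using h9
  constructor
  · intro hz0
    rw [hg'.count] at hz0
    obtain ⟨gs, F, v, hi1, hF, rfl⟩ := hs.resolve_left fun hs => hz0 hs.2
    rw [wp_seq]
    refine wp_adjustLocus hg' hi hw him hM hT hF fun g₁ v₁ hg₁ a1 a2 _ a4 => ?_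
    refine wp_extendFactor hi hg₁ hw him hdm hσ hM hT hf hL3 a2 hF a4 fun g₂ x hg₂ b1 b2 b3 => ?_
    rw [wp_ite, wp_skip]
    constructor
    · intro hne
      obtain ⟨v', rfl, hF'⟩ := b2 hne
      exact hQ _ _ _ _ _ _ hg₂ hF'
    · intro hz
      exact wp_newFactor hi hg₂ hw him hF.count_le hσ hM hT (b1.trans (a1.trans h9'))
        (.inr ⟨gs, F, v, hF, b3 hz⟩) hQ
  · intro hz0
    rw [hg'.count] at hz0
    have hi0 : i = 0 := by
      rcases hs with hs | ⟨gs, F, v, _, hF, _⟩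
      · exact hs.1
      · have := hF.count
        omega
    rw [wp_skip, wp_ite]
    exact ⟨fun hne => absurd (by simp) hne, fun _ =>
      wp_newFactor hi hg' hw him (by omega) hσ hM hT h9' (.inl ⟨hi0, hz0⟩) hQ⟩

theorem wp_storeState {c s z : ℕ} {gs : List (List ℕ)} {F v : List ℕ} (hi : i < T.length)
    (hg : Vars g c (i + 1) s z (h v)) (hw : 2 * m ≤ 2 ^ w) (him : i + 1 < m) (hdm : d ≤ m)
    (hT : TreeState D w σ N d T h (i + 1) M) (hf : TableInv T h (i + 1) (L 2))
    (hF : FactorInv T (i + 1) z s gs F v)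
    (hQ : ∀ g' L', g' 5 = s → g' 6 = z → Reports (T.take (i + 1)) z s (g' 14) →
      (∀ o < 5, L' o = L o) → L' 5 0 = s → L' 6 0 = z → L' 7 0 = h v → Q g' L') :
    storeState.wp w N d m g L Q := by
  have hlen := hF.length hi
  have hF0 := List.length_pos_iff.2 hF.ne_nil
  have hj := hf.1 (by omega) v hF.locus.1
  have hji := hj.le (by omega) hF.locus.1.infix
  have hrep := hF.reports (by omega) hi hj
  -- The bound `|F| ≤ j` makes the subtraction in `j + s - (i + 1)` legitimate; the sum `j + s` fits
  -- into a word because both terms are at most `i + 1` and `2 * m ≤ 2 ^ w`.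
  have hjF := (hF.locus.firstOcc (by omega) hj).2.1.length_le
  rw [length_revPrefix (by omega)] at hjF
  simp only [storeState, wp_seq, wp_read, wp_lt, wp_const, wp_ite, wp_add, wp_sub, wp_write,
    wp_skip]
  refine ⟨by rw [hg.locus]; exact (hT.lt v hF.locus.1).trans_le hdm, fun hne => ?_, fun hz => ?_⟩
  · have hlt : L 2 (h v) < s := by
      by_contra hge
      simp [hg.locus, hg.start, hge] at hne
    rw [if_pos hlt] at hrep
    refine ⟨?_, ?_, ?_, ?_, ?_, ?_, hQ _ _ ?_ ?_ ?_ ?_ ?_ ?_ ?_⟩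
    all_goals try simp [hg.locus, hg.start, hg.count, hg.zero, hg.length]
    any_goals first | exact hrep | omega
    · intro o ho
      have h5 : o ≠ 5 := by omega
      have h6 : o ≠ 6 := by omega
      have h7 : o ≠ 7 := by omega
      simp [h5, h6, h7]
  · have hge : ¬ L 2 (h v) < s := by
      intro hlt
      simp [hg.locus, hg.start, hlt] at hz
    rw [if_neg hge] at hrep
    refine ⟨?_, ?_, ?_, hQ _ _ ?_ ?_ ?_ ?_ ?_ ?_ ?_⟩
    all_goals try simp [hg.locus, hg.start, hg.count, hg.zero]
    any_goals first | exact hrep | omega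
    · intro o ho
      have h5 : o ≠ 5 := by omega
      have h6 : o ≠ 6 := by omega
      have h7 : o ≠ 7 := by omega
      simp [h5, h6, h7]

end WP

/-- The lanes `L` hold the correct state after `i` letters of `T`. -/
structure StepInv (T : List ℕ) (h : List ℕ → ℕ) (M : ℕ → ℕ → ℕ) (i : ℕ) (L : ℕ → ℕ → ℕ) :
    Prop where
  copy₀ : L 0 = M i
  copy₁ : L 1 = M i
  table : TableInv T h i (L 2)
  text : ∀ k (_ : k < T.length), k < i → L 3 (k + 1) = T[k]
  length : L 4 0 = i
  state : StateInv T h i (L 6 0) (L 5 0) (L 7 0)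

theorem StepInv.congr {T : List ℕ} {h : List ℕ → ℕ} {M : ℕ → ℕ → ℕ} {i : ℕ} {L L' : ℕ → ℕ → ℕ}
    (hL : StepInv T h M i L) (hLL' : ∀ o < 8, L' o = L o) : StepInv T h M i L' := by
  obtain ⟨h0, h1, h2, h3, h4, h5⟩ := hL
  constructor <;> simpa [hLL']

theorem stepInv_zero {T : List ℕ} {h : List ℕ → ℕ} {M : ℕ → ℕ → ℕ} (hM : M 0 = fun _ => 0) :
    StepInv T h M 0 fun _ _ => 0 :=
  ⟨hM.symm, hM.symm, tableInv_zero T h, fun _ _ hk => absurd hk (Nat.not_lt_zero _), rfl,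
    .inl ⟨rfl, rfl⟩⟩

theorem wp_letterStep {w N d m i σ : ℕ} {g : ℕ → ℕ} {L M : ℕ → ℕ → ℕ} {D : SuffixTreeProgram}
    {T : List ℕ} {h : List ℕ → ℕ} {out : ℕ → ℕ} (hi : i < T.length) (hg3 : g 3 = T[i])
    (hg15 : g 15 = 0) (hw : 2 * m ≤ 2 ^ w) (him : i + 1 < m) (hdm : d ≤ m)
    (hσ : ∀ a ∈ T, a < σ) (hinj : Set.InjOn h {u | IsNode (revPrefix T T.length) u})
    (hT : 1 ≤ i → TreeState D w σ N d T h i (M i))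
    (hT' : TreeState D w σ N d T h (i + 1) (M (i + 1)))
    (hup : Call w D.update [T[i], 0] (M i) (M (i + 1)) out N d)
    (h0 : out 0 = h (revPrefix T (i + 1))) (h1 : out 1 = h []) (hL : StepInv T h M i L) :
    (letterStep D).wp w N d m g L fun g' L' => StepInv T h M (i + 1) L' ∧
      Reports (T.take (i + 1)) (g' 6) (g' 5) (g' 14) := by
  have hw' : m ≤ 2 ^ w := by omega
  unfold letterStep
  rw [wp_seq]
  refine wp_loadState hg3 hg15 hL.length him hw' fun g₁ L₁ hg₁ a0 a1 a2 a3 a4 => ?_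
  rw [wp_seq]
  refine wp_insertLeaf hg₁ hup (a1.trans hL.copy₁) h0 h1
    (fun u hu => (hT'.lt u hu).trans_le hdm) fun g₂ L₂ hg₂ b8 b9 b0 b1 b2 b3 b4 => ?_
  have hL3 : ∀ k (_ : k < T.length), k ≤ i → L₂ 3 (k + 1) = T[k] := by
    intro k hk hki
    rw [b3, a3]
    rcases hki.lt_or_eq with hlt | rfl
    · rw [Function.update_of_ne (by omega)]
      exact hL.text k hk hlt
    · simp
  rw [wp_seq]
  refine wp_insertParent hg₂ hi hinj hσ hw' him hdm (b0.trans (a0.trans hL.copy₀)) b1 hT hT'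
    hL.table (by rw [b2, a2]) hL3 b8 fun g₃ L₃ hg₃ c9 c0 c1 c2 c3 c4 => ?_
  rw [wp_seq]
  refine wp_update hup c0 hg₃.letter hg₃.zero ?_
  have hg₄ : Vars (withResults g₃ out) T[i] (i + 1) (L 5 0) (L 6 0) (L 7 0) :=
    hg₃.congr (by simp [withResults_of_le]) (by simp [withResults_of_le])
      (by simp [withResults_of_le]) (by simp [withResults_of_le]) (by simp [withResults_of_le])
      (by simp [withResults_of_le]) (by simp [withResults_of_le])
  have h9 : withResults g₃ out 9 = h [] := by
    rw [withResults_of_le (by omega), c9, b9]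
  have hL3' : ∀ k (_ : k < T.length), k ≤ i →
      Function.update L₃ 0 (M (i + 1)) 3 (k + 1) = T[k] := by
    intro k hk hki
    rw [Function.update_of_ne (by omega), c3]
    exact hL3 k hk hki
  have key := wp_factor (Q := fun g' L' => storeState.wp w N d m g' L' fun g' L' =>
      StepInv T h M (i + 1) L' ∧ Reports (T.take (i + 1)) (g' 6) (g' 5) (g' 14)) hi hg₄ hw' him hdm
    hσ (L := Function.update L₃ 0 (M (i + 1))) (by simpa using c1) hT' (by simpa using c2) hL3' h9
    hL.state fun g₅ s z gs F v hg₅ hF => wp_storeState hi hg₅ hw him hdm hT' (by simpa using c2)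
      hF fun g₆ L₆ d5 d6 d14 e e5 e6 e7 => ⟨⟨?_, ?_, ?_, ?_, ?_, ?_⟩, by rwa [d5, d6]⟩
  · exact key
  · simp [e]
  · simpa [e] using c1
  · simpa [e] using c2
  · intro k hk hki
    rw [e 3 (by omega)]
    exact hL3' k hk (by omega)
  · rw [e 4 (by omega), Function.update_of_ne (by omega), c4, b4]
    exact a4
  · exact .inr ⟨gs, F, v, by omega, by rwa [e5, e6], e7⟩

/-! ### The program -/

/-- The program for reversed Lempel-Ziv factorization. -/
def revLZProg (D : SuffixTreeProgram) (R : ℕ) : Prog :=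
  .seq (.op .or (R + 2 + 3) 0 0) <| .seq ((letterStep D).compile R) <|
  .seq (.op .or 0 (R + 2 + 6) (R + 2 + 6)) <| .seq (.op .or 1 (R + 2 + 5) (R + 2 + 5))
    (.op .or 2 (R + 2 + 14) (R + 2 + 14))

theorem letterStep_valid {D : SuffixTreeProgram} {R : ℕ} (hu : D.update.RegBelow R)
    (hn : D.node.RegBelow R) (hc : D.child.RegBelow R) : (letterStep D).Valid R := by
  simp [letterStep, loadState, insertLeaf, insertParent, adjustLocus, extendFactor, newFactor,
    storeState, Cmd.Valid, hu, hn, hc]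

theorem revLZProg_step {w N d m i σ R : ℕ} {M : ℕ → ℕ → ℕ} {D : SuffixTreeProgram}
    {T : List ℕ} {h : List ℕ → ℕ} {out : ℕ → ℕ} (hR : 3 ≤ R) (hu : D.update.RegBelow R)
    (hn : D.node.RegBelow R) (hc : D.child.RegBelow R) (hN : 1 ≤ N) (hi : i < T.length)
    (hw : 8 * m ≤ 2 ^ w) (him : i + 1 < m) (hdm : d ≤ m)
    (hσ : ∀ a ∈ T, a < σ) (hinj : Set.InjOn h {u | IsNode (revPrefix T T.length) u})
    (hT : 1 ≤ i → TreeState D w σ N d T h i (M i))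
    (hT' : TreeState D w σ N d T h (i + 1) (M (i + 1)))
    (hup : Call w D.update [T[i], 0] (M i) (M (i + 1)) out N d)
    (h0 : out 0 = h (revPrefix T (i + 1))) (h1 : out 1 = h []) {mem : ℕ → ℕ}
    (hL : StepInv T h M i fun o a => mem (8 * a + o)) :
    Runs w (revLZProg D R) ⟨fun j => [T[i]].getD j 0, mem⟩
      (((letterStep D).cost R + 4) * N) (8 * m)
      fun t => StepInv T h M (i + 1) (fun o a => t.mem (8 * a + o)) ∧
        Reports (T.take (i + 1)) (t.reg 0) (t.reg 1) (t.reg 2) := by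
  have hrun : Runs w (revLZProg D R) ⟨fun j => [T[i]].getD j 0, mem⟩
      (1 + ((letterStep D).cost R * N + (1 + (1 + 1)))) (8 * m)
      fun t => StepInv T h M (i + 1) (fun o a => t.mem (8 * a + o)) ∧
        Reports (T.take (i + 1)) (t.reg 0) (t.reg 1) (t.reg 2) := by
    refine Runs.seq <| Runs.move <| Runs.seq ?_
    -- All registers except the argument start at `0`, so the variables are zero apart from the
    -- letter; in particular variable `15` is the required zero.
    have hwp := wp_letterStep (g := Function.update (fun _ => 0) 3 T[i]) hi (by simp) (by simp)
      (by omega) him hdm hσ hinj hT hT' hup h0 h1 hL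
    refine (Cmd.wp_sound hN hR hdm hw (by omega) _ (letterStep_valid hu hn hc) hwp _
      ⟨fun k => ?_, fun o ho a => rfl⟩).mono le_rfl le_rfl ?_
    · by_cases hk : k = 3
      · subst hk; simp
      · have h1 : R + 2 + k ≠ R + 2 + 3 := by omega
        rw [Function.update_of_ne hk]
        refine (Function.update_of_ne h1 _ _).trans ?_
        exact List.getD_eq_default _ _ (by simp; omega)
    · rintro t ⟨g', L', hrep, hinv, hrepo⟩
      have n1 : R + 2 + 5 ≠ 0 := by omega
      have n2 : R + 2 + 14 ≠ 0 := by omega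
      have n3 : R + 2 + 14 ≠ 1 := by omega
      refine Runs.seq <| Runs.move <| Runs.seq <| Runs.move <| Runs.move ⟨?_, ?_⟩
      · exact hinv.congr fun o ho => funext fun a => hrep.2 o ho a
      · simpa [Function.update_apply, n1, n2, n3, hrep.1] using hrepo
  refine hrun.mono ?_ le_rfl fun _ h => h
  linarith

/-- Ensures that the time bound of the data structure is at least `1`, so that constant overhead is
absorbed into a multiple of it. -/
theorem Exec.pos {w : ℕ} {p : Prog} {s s' : Config} {τ m : ℕ} (h : Exec w p s s' τ m) :
    1 ≤ τ := by
  induction h <;> omega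

/-- Turns the one-letter step, which preserves the invariant `P`, into the sequence of memories
demanded by `RevLZOnline`. -/
theorem exists_iterate {α : Type*} {P : ℕ → α → Prop} {R : ℕ → α → α → Prop} {n : ℕ} {a : α}
    (h0 : P 0 a) (hs : ∀ i < n, ∀ x, P i x → ∃ y, R i x y ∧ P (i + 1) y) :
    ∃ M : ℕ → α, M 0 = a ∧ ∀ i < n, R i (M i) (M (i + 1)) := by
  classical
  choose! f hf using hs
  refine ⟨fun i => Nat.rec a (fun i x => f i x) i, rfl, fun i hi => ?_⟩
  have hP : ∀ j ≤ n, P j (Nat.rec a (fun i x => f i x) j : α) := by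
    intro j
    induction j with
    | zero => exact fun _ => h0
    | succ j ih => exact fun hj => (hf j (by omega) _ (ih (by omega))).2
  exact (hf i hi _ (hP i hi.le)).1

end RevLZ

theorem mainTheorem7 (adm : ℕ → ℕ → Prop) (tSU : ℕ → ℕ → ℝ)
    (D : RevLZ.SuffixTreeProgram) (hD : D.Solves adm tSU) :
    ∃ p : RevLZ.Prog, RevLZ.ComputesRevLZ p adm tSU := by
  open RevLZ in
  obtain ⟨R₁, hR₁⟩ := D.update.exists_regBelow
  obtain ⟨R₂, hR₂⟩ := D.node.exists_regBelow
  obtain ⟨R₃, hR₃⟩ := D.child.exists_regBelow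
  obtain ⟨C, hC⟩ := hD
  obtain ⟨R, hR⟩ : ∃ R, R = R₁ + R₂ + R₃ + 3 := ⟨_, rfl⟩
  obtain ⟨K, hK⟩ : ∃ K, K = (letterStep D).cost R + 4 := ⟨_, rfl⟩
  -- The summand `K * C` pays for time. The other pays for eight lanes of `(C + 2) * (i + 1)` cells,
  -- enough for the pointers and trees (`C * (i + 1)`) and for the text cell `i + 1`.
  refine ⟨revLZProg D R, K * C + 8 * (C + 2), fun n σ w T hadm hn hσ hw hσw => ?_⟩
  have hCw : C * (n + 1) ≤ 2 ^ w := le_trans (Nat.mul_le_mul_right _ (by omega)) hw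
  obtain ⟨M, h, hM0, hinj, hstep⟩ := (hC n σ w T hadm hn hσ hCw hσw).treeState
  have hone : ∀ i < T.length, ∀ mem : ℕ → ℕ, StepInv T h M i (fun o a => mem (8 * a + o)) →
      -- The bound on `i` is repeated inside, since the relation given to `exists_iterate` must make
      -- sense for every `i`, while `T[i]` needs the bound.
      ∃ mem' : ℕ → ℕ, (∀ hi : i < T.length, ∃ out, Call w (revLZProg D R) [T[i]] mem mem' out
        ((K * C + 8 * (C + 2) : ℕ) * tSU n σ) ((K * C + 8 * (C + 2)) * (i + 1)) ∧
        Reports (T.take (i + 1)) (out 0) (out 1) (out 2)) ∧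
        StepInv T h M (i + 1) (fun o a => mem' (8 * a + o)) := by
    intro i hi mem hinv
    obtain ⟨hT', out, hup, h0, h1⟩ := hstep i hi
    have hN : 1 ≤ ⌊(C : ℝ) * tSU n σ⌋₊ := by
      obtain ⟨τ, _, he, hτ, _⟩ := hup
      exact he.pos.trans (by exact_mod_cast hτ)
    have hpos : (1 : ℝ) ≤ C * tSU n σ := (Nat.one_le_floor_iff _).1 hN
    have hT : 1 ≤ i →
        TreeState D w σ ⌊(C : ℝ) * tSU n σ⌋₊ (C * (i + 1)) T h i (M i) := by
      intro hi1
      have := (hstep (i - 1) (by omega)).1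
      rw [Nat.sub_add_cancel hi1] at this
      exact this.mono (Nat.mul_le_mul_left _ (by omega))
    have hmw : 8 * ((C + 2) * (i + 1)) ≤ 2 ^ w := by
      refine le_trans ?_ hw
      have : i + 1 ≤ n + 1 := by omega
      calc 8 * ((C + 2) * (i + 1)) ≤ 8 * ((C + 2) * (n + 1)) := by gcongr
        _ = (8 * (C + 2)) * (n + 1) := by ring
        _ ≤ (K * C + 8 * (C + 2)) * (n + 1) := Nat.mul_le_mul_right _ (by omega)
    obtain ⟨t, τ, m', he, hτ, hm', hinv', hrep⟩ := revLZProg_step (R := R)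
      (by omega)
      (hR₁.mono (by omega)) (hR₂.mono (by omega)) (hR₃.mono (by omega)) hN hi hmw
      (by nlinarith) (Nat.mul_le_mul_right _ (by omega)) hσ hinj hT hT' hup h0 h1 hinv
    refine ⟨t.mem, fun _ => ⟨t.reg, ⟨τ, m', he, ?_, ?_⟩, hrep⟩, hinv'⟩
    · rw [← hK] at hτ
      have hfl : (⌊(C : ℝ) * tSU n σ⌋₊ : ℝ) ≤ C * tSU n σ := Nat.floor_le (by linarith)
      -- `tSU` is an arbitrary real function; it is nonnegative here because `C * tSU n σ ≥ 1`.
      have ht : 0 ≤ tSU n σ := by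
        by_contra! hneg
        have : (C : ℝ) * tSU n σ ≤ 0 := mul_nonpos_of_nonneg_of_nonpos (by positivity) hneg.le
        linarith
      calc (τ : ℝ) ≤ (K * ⌊(C : ℝ) * tSU n σ⌋₊ : ℕ) := by exact_mod_cast hτ
        _ ≤ K * (C * tSU n σ) := by push_cast; gcongr
        _ ≤ ((K * C + 8 * (C + 2) : ℕ) : ℝ) * tSU n σ := by
          push_cast
          have : 0 ≤ 8 * ((C : ℝ) + 2) * tSU n σ := by positivity
          linarith
    · refine hm'.trans ?_
      rw [← mul_assoc]
      exact Nat.mul_le_mul_right _ (by omega)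
  obtain ⟨Mem, hMem0, hMem⟩ := exists_iterate
    (P := fun i mem => StepInv T h M i (fun o a => mem (8 * a + o)))
    (a := fun _ => 0) (stepInv_zero hM0) hone
  exact ⟨Mem, fun a => congrFun hMem0 a, fun i hi => hMem i hi hi⟩
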